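/- Let $G$ be a nilpotent group with a finite symmetric generating set $S=S^{-1}$ and identity $e$. Let $d$ be the word metric of $S$ on $G$ (the path metric of the Cayley graph with edges $\{u,us\}$, $s\in S$). For $z\in G$ put $\psi_z(x)=d(x,z)-d(e,z)$, and let $$\partial G=\overline{\{\psi_z : z\in G\}}\setminus\{\psi_z : z\in G\},$$ the closure being taken in $\mathbb R^G$ with pointwise convergence, be the horofunction boundary, on which $G$ acts by $(g\cdot\xi)(x)=\xi(g^{-1}x)-\xi(g^{-1})$. A geodesic path is an isometry $\gamma:\mathbb N\to G$; its direction is the set of elements $s$ that occur infinitely often among its steps $\gamma(n)^{-1}\gamma(n+1)$; it converges to $\xi\in\partial G$ if $\psi_{\gamma(n)}\to\xi$. A Busemann point is an element of $\partial G$ that is the limit of a geodesic path. Let $Z_0$ be the torsion subgroup of the abelianisation $G/[G,G]$, fix an isomorphism $(G/[G,G])/Z_0\cong\mathbb Z^N\subset\mathbb R^N$, let $\phi:G\to\mathbb R^N$ be the resulting projection, and let $P=\operatorname{conv}(\phi(S))$. The facets of $P$ are its non-empty faces of dimension $\dim P-1$. For a facet $F$ of $P$ put $V_F=\{s\in S:\phi(s)\in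 F\}$. The simple commutators of $V_F$ form the smallest set that contains $V_F$ and contains $c^{-1}s^{-1}cs$ whenever it contains $c$ and $s\in V_F$. Write $\overline x$ for the element of $G$ represented by a word $x$. Call a finite word $w$ with letters in $V_F$ an $F$-word if for every simple commutator $c$ of $V_F$ there are (contiguous, possibly empty) subwords $x,y$ of $w$ with $c\,\overline x=\overline y$. Then there is a bijection $\Phi$ from the set of facets of $P$ onto the set of finite $G$-orbits of Busemann points that is natural in the following sense. 1. For every facet $F$, an $F$-word exists, and for every $F$-word $w$ the path that starts at $e$ and has steps $w\,w\,w\cdots$ is geodesic and converges to a Busemann point whose orbit is $\Phi(F)$. 2. For every facet $F$ and every geodesic path $\gamma$ converging to a point $\xi\in\partial G$ whose orbit is finite, $\xi\in\Phi(F)$ if and only if $\phi$ maps the direction of $\gamma$ into $F$. -/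

import Mathlib

open Filter Topology

noncomputable section

namespace NilpotentHoro

variable {G : Type*} [Group G]

/-- The word length distance on `G`: the length of the shortest path between `u` and `v` in the
Cayley graph of `G`, which has an edge between `u` and `u * s` for every `u : G` and `s ∈ S`. -/
def wordDist (S : Set G) (u v : G) : ℕ :=
  (SimpleGraph.mulCayley S).dist u v

theorem wordDist_mul_left (S : Set G) (g u v : G) :
    wordDist S (g * u) (g * v) = wordDist S u v := by
  have key : ∀ (a x y : G) (w : (SimpleGraph.mulCayley S).Walk x y),
      ∃ w' : (SimpleGraph.mulCayley S).Walk (a * x) (a * y), w'.length = w.length := by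
    intro a x y w
    induction w with
    | nil => exact ⟨SimpleGraph.Walk.nil, rfl⟩
    | cons h p ih =>
      obtain ⟨p', hp'⟩ := ih
      exact ⟨SimpleGraph.Walk.cons (SimpleGraph.mulCayley_adj_mul_iff_right.2 h) p',
        by simp [hp']⟩
  unfold wordDist
  rw [SimpleGraph.dist_eq_sInf, SimpleGraph.dist_eq_sInf]
  congr 1
  ext n
  constructor
  · rintro ⟨w, rfl⟩
    obtain ⟨w', hw'⟩ := key g⁻¹ _ _ w
    exact ⟨w'.copy (by group) (by group), by simpa using hw'⟩
  · rintro ⟨w, rfl⟩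
    obtain ⟨w', hw'⟩ := key g _ _ w
    exact ⟨w', hw'⟩

/-- The function `x ↦ d(x, z) - d(e, z)` associated to the point `z`, with the identity `e` as
base-point. -/
def psi (S : Set G) (z : G) : G → ℝ :=
  fun x => (wordDist S x z : ℝ) - (wordDist S 1 z : ℝ)

/-- The horofunction boundary of `G`. As `G` is discrete, all functions on `G` are continuous and
uniform convergence on compact sets is pointwise convergence, so the closure is taken in the
product topology of `G → ℝ`. -/
def horoBoundary (S : Set G) : Set (G → ℝ) :=
  closure (Set.range (psi S)) \ Set.range (psi S)

/-- The translate `g · ξ` of a function `ξ` by `g`. -/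
def translate (g : G) (ξ : G → ℝ) : G → ℝ :=
  fun x => ξ (g⁻¹ * x) - ξ (g⁻¹ * 1)

theorem translate_psi (S : Set G) (g z : G) : translate g (psi S z) = psi S (g * z) := by
  funext x
  have h : ∀ y, wordDist S (g⁻¹ * y) z = wordDist S y (g * z) := fun y => by
    rw [← wordDist_mul_left S g (g⁻¹ * y) z, mul_inv_cancel_left]
  simp only [translate, psi, h]
  ring

theorem translate_translate (g h : G) (ξ : G → ℝ) :
    translate g (translate h ξ) = translate (g * h) ξ := by
  funext x
  simp [translate, mul_assoc]

theorem continuous_translate (g : G) : Continuous (translate g : (G → ℝ) → G → ℝ) := by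
  unfold translate
  fun_prop

theorem apply_one_of_mem_closure {S : Set G} {ξ : G → ℝ}
    (h : ξ ∈ closure (Set.range (psi S))) : ξ 1 = 0 := by
  have hc : IsClosed {f : G → ℝ | f 1 = 0} :=
    isClosed_eq (continuous_apply 1) continuous_const
  refine closure_minimal ?_ hc h
  rintro _ ⟨z, rfl⟩
  simp [psi]

theorem translate_one {S : Set G} {ξ : G → ℝ} (h : ξ ∈ closure (Set.range (psi S))) :
    translate 1 ξ = ξ := by
  funext x
  simp [translate, apply_one_of_mem_closure h]

theorem translate_mem {S : Set G} (g : G) {ξ : G → ℝ} (h : ξ ∈ horoBoundary S) :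
    translate g ξ ∈ horoBoundary S := by
  refine ⟨?_, ?_⟩
  · refine map_mem_closure (continuous_translate g) h.1 ?_
    rintro _ ⟨z, rfl⟩
    exact ⟨g * z, (translate_psi S g z).symm⟩
  · rintro ⟨z, hz⟩
    refine h.2 ⟨g⁻¹ * z, ?_⟩
    rw [← translate_psi, hz, translate_translate, inv_mul_cancel, translate_one h.1]

/-- The action of `G` on its horofunction boundary. -/
instance horoAction (S : Set G) : MulAction G (horoBoundary S) where
  smul g ξ := ⟨translate g ξ.1, translate_mem g ξ.2⟩
  one_smul ξ := Subtype.ext (translate_one ξ.2.1)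
  mul_smul g h ξ := Subtype.ext (translate_translate g h ξ.1).symm

/-- A geodesic path (ray): an isometry from `ℕ` to `G`. -/
def IsGeodesicPath (S : Set G) (γ : ℕ → G) : Prop :=
  ∀ m n : ℕ, (wordDist S (γ m) (γ n) : ℤ) = |(m : ℤ) - (n : ℤ)|

/-- The path `γ` converges to the point `ξ` of the horofunction boundary. -/
def ConvergesTo (S : Set G) (γ : ℕ → G) (ξ : horoBoundary S) : Prop :=
  Tendsto (fun n => psi S (γ n)) atTop (𝓝 (ξ : G → ℝ))

/-- Busemann points are the limits of geodesic paths. -/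
def IsBusemannPoint (S : Set G) (ξ : horoBoundary S) : Prop :=
  ∃ γ : ℕ → G, IsGeodesicPath S γ ∧ ConvergesTo S γ ξ

/-- The set of all finite orbits of Busemann points. -/
def finiteBusemannOrbits (S : Set G) : Set (Set (horoBoundary S)) :=
  {O | O.Finite ∧ ∃ ξ : horoBoundary S, IsBusemannPoint S ξ ∧ O = MulAction.orbit G ξ}

/-- The direction of a path: the set of those elements that occur infinitely often as steps. -/
def direction (γ : ℕ → G) : Set G :=
  {s | ∃ᶠ n in atTop, (γ n)⁻¹ * γ (n + 1) = s}

/-- The projection `G → (G / [G, G]) / Z₀ ≅ ℤ ^ N ⊆ ℝ ^ N`, where `Z₀` is the torsion subgroup of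
the abelianisation and `e` is the chosen identification with `ℤ ^ N`. -/
def proj {N : ℕ}
    (e : Additive (Abelianization G ⧸ CommGroup.torsion (Abelianization G)) ≃+ (Fin N → ℤ))
    (g : G) : Fin N → ℝ :=
  fun i => (e (Additive.ofMul (QuotientGroup.mk (Abelianization.of g))) i : ℝ)

/-- The convex hull `P` of the image of `S`. -/
def polytope (S : Set G) {N : ℕ}
    (e : Additive (Abelianization G ⧸ CommGroup.torsion (Abelianization G)) ≃+ (Fin N → ℤ)) :
    Set (Fin N → ℝ) :=
  convexHull ℝ (proj e '' S)

/-- The facets of a convex polytope `P`: its non-empty faces of dimension `dim P - 1`. -/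
def facets {N : ℕ} (P : Set (Fin N → ℝ)) : Set (Set (Fin N → ℝ)) :=
  {F | IsExposed ℝ P F ∧ F.Nonempty ∧
    Module.finrank ℝ (vectorSpan ℝ F) + 1 = Module.finrank ℝ (vectorSpan ℝ P)}

/-- The generators that the projection maps into `F`. -/
def generatorsOver (S : Set G) {N : ℕ}
    (e : Additive (Abelianization G ⧸ CommGroup.torsion (Abelianization G)) ≃+ (Fin N → ℤ))
    (F : Set (Fin N → ℝ)) : Set G :=
  {s ∈ S | proj e s ∈ F}

/-- The simple commutators (of all weights `≥ 1`) of elements of `V`. -/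
inductive SimpleCommutator (V : Set G) : G → Prop
  | base {s : G} : s ∈ V → SimpleCommutator V s
  | step {c s : G} : SimpleCommutator V c → s ∈ V → SimpleCommutator V (c⁻¹ * s⁻¹ * c * s)

/-- A finite word with letters in `V` having, for every simple commutator `c` of elements of `V`,
subwords `x` and `y` such that `c` times the element represented by `x` is the element represented
by `y`. -/
def IsFacetWord (V : Set G) (w : List G) : Prop :=
  (∀ s ∈ w, s ∈ V) ∧
    ∀ c : G, SimpleCommutator V c → ∃ x y : List G, x <:+: w ∧ y <:+: w ∧ c * x.prod = y.prod

/-- The path that starts at the identity and has steps given by the infinite word `w w w ⋯`. -/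
def periodicPath (w : List G) (n : ℕ) : G :=
  w.prod ^ (n / w.length) * (w.take (n % w.length)).prod

end NilpotentHoro

end

/-! A facet `F` is cut out of `P` by a linear functional `f ≤ 1` with `f = 1` on `F`. Put `h = f ∘
φ`, a homomorphism that is at most `1` on `S` and equals `1` exactly on the generators `V_F`. As
`φ(V_F)` spans `ℝ ^ N`, nilpotency makes the subgroup `H` generated by `V_F` of finite index
(`finiteIndex_of_forall_isAdditive`).

The word metric dominates the increments of `h`, with equality exactly along products of letters of
`V_F`. So paths with steps in `V_F` are geodesic. If such a path in `H` can be reached from all of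
`H` by `V_F`-steps (`IsFacetRay`), then its limit does not depend on the path
(`IsFacetRay.limit_unique`). Hence `H` fixes the limit, whose orbit is therefore finite. On `H` the
limit is `-h`, so its orbit determines `h` and `F`. An `F`-word yields such a path: its powers
absorb every element of `H` into the monoid of `V_F` (`IsFacetWord.exists_mul_pow_mem`), by descent
along the lower central series.

Conversely, let `ξ` be the limit of a geodesic `γ` and have a finite orbit. Then `ξ` is additive on
a normal subgroup of finite index, and by nilpotency `-ξ` extends from there to a homomorphism `h`
on `G`. Since `ξ + h` takes finitely many values, `h` eventually grows by exactly `1` along `γ`.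
This makes a translated tail of `γ` a facet ray, and `{h = 1}` cuts out a facet
(`IsGeodesicPath.exists_isFacetHom`). -/

namespace NilpotentHoro

/-! ### Homomorphisms to `ℝ` and subgroups of finite index -/

/-- Real-valued homomorphisms on a multiplicative group. -/
def IsAdditive {G : Type*} [Group G] (h : G → ℝ) : Prop :=
  ∀ a b, h (a * b) = h a + h b

namespace IsAdditive

variable {G : Type*} [Group G] {h : G → ℝ}

theorem map_one (hh : IsAdditive h) : h 1 = 0 := by
  have := hh 1 1
  rw [mul_one] at this
  linarith

theorem map_inv (hh : IsAdditive h) (a : G) : h a⁻¹ = -h a := by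
  have := hh a⁻¹ a
  rw [inv_mul_cancel, hh.map_one] at this
  linarith

theorem map_pow (hh : IsAdditive h) (a : G) (n : ℕ) : h (a ^ n) = n * h a := by
  induction n with
  | zero => simp [hh.map_one]
  | succ n ih => rw [pow_succ, hh, ih]; push_cast; ring

theorem map_conj (hh : IsAdditive h) (a b : G) : h (a⁻¹ * b * a) = h b := by
  rw [hh, hh, hh.map_inv]; ring

/-- A homomorphism is determined by its values on a subgroup of finite index. -/
theorem eq_of_eq_on {h' : G → ℝ} (hh : IsAdditive h) (hh' : IsAdditive h') (H : Subgroup G)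
    [hH : H.FiniteIndex] (he : ∀ a ∈ H, h a = h' a) : h = h' := by
  funext g
  obtain ⟨m, hm, -, hmem⟩ := Subgroup.exists_pow_mem_of_index_ne_zero hH.index_ne_zero g
  have := he _ hmem
  rw [hh.map_pow, hh'.map_pow] at this
  exact mul_left_cancel₀ (by positivity) this

end IsAdditive

section GroupTheory

variable {G : Type*} [Group G]

theorem commutator_mem_lowerCentralSeries_succ {n : ℕ} {c : G}
    (hc : c ∈ (⊤ : Subgroup G).lowerCentralSeries n) (s : G) :
    c⁻¹ * s⁻¹ * c * s ∈ (⊤ : Subgroup G).lowerCentralSeries (n + 1) := by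
  have := Subgroup.commutator_mem_commutator (inv_mem hc) (Subgroup.mem_top s⁻¹)
  rw [Subgroup.lowerCentralSeries_succ]
  simpa [commutatorElement_def] using this

/-- In a nilpotent group, every homomorphism from a normal subgroup of finite index to `ℝ` is
invariant under conjugation. -/
theorem map_conj_of_additive_on [Group.IsNilpotent G] (K : Subgroup G) [K.Normal]
    [hK : K.FiniteIndex] (η : G → ℝ) (hη : ∀ a ∈ K, ∀ b ∈ K, η (a * b) = η a + η b)
    (g : G) (k : G) (hk : k ∈ K) : η (g⁻¹ * k * g) = η k := by
  obtain ⟨N, hN⟩ := Subgroup.nilpotent_iff_lowerCentralSeries.1 ‹Group.IsNilpotent G›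
  have hone : η 1 = 0 := by
    have := hη 1 K.one_mem 1 K.one_mem
    rw [mul_one] at this
    linarith
  have hinv : ∀ a ∈ K, η a⁻¹ = -η a := fun a ha => by
    have := hη _ (inv_mem ha) a ha
    rw [inv_mul_cancel, hone] at this
    linarith
  have hconj : ∀ g k : G, k ∈ K → g⁻¹ * k * g ∈ K := fun g k hk => by
    simpa using ‹K.Normal›.conj_mem k hk g⁻¹
  -- Descending induction along the lower central series: the commutator of `k` and `g` lies one
  -- term deeper, so its value is already invariant. Conjugating by `g ^ n` then adds `n` times this
  -- value. Some power of `g` lies in `K`, where conjugation changes nothing, so the value is `0`.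
  have key : ∀ j i : ℕ, i + j = N → ∀ g k : G, k ∈ K →
      k ∈ (⊤ : Subgroup G).lowerCentralSeries i → η (g⁻¹ * k * g) = η k := by
    intro j
    induction j with
    | zero =>
      intro i hi g k _ hki
      rw [add_zero] at hi
      rw [hi, hN, Subgroup.mem_bot] at hki
      simp [hki]
    | succ j ih =>
      intro i hi g k hk hki
      have hcK : k⁻¹ * g⁻¹ * k * g ∈ K := by
        have := mul_mem (inv_mem hk) (hconj g k hk)
        simpa [mul_assoc] using this
      have hci := commutator_mem_lowerCentralSeries_succ hki g
      have hstep : ∀ n : ℕ,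
          η ((g ^ n)⁻¹ * k * g ^ n) = η k + n * η (k⁻¹ * g⁻¹ * k * g) := by
        intro n
        induction n with
        | zero => simp
        | succ n ihn =>
          have h1 : (g ^ (n + 1))⁻¹ * k * g ^ (n + 1) = ((g ^ n)⁻¹ * k * g ^ n) *
              ((g ^ n)⁻¹ * (k⁻¹ * g⁻¹ * k * g) * g ^ n) := by
            rw [pow_succ']; group
          rw [h1, hη _ (hconj _ _ hk) _ (hconj _ _ hcK), ihn,
            ih (i + 1) (by omega) (g ^ n) _ hcK hci]
          push_cast; ring
      obtain ⟨m, hm, -, hmem⟩ := Subgroup.exists_pow_mem_of_index_ne_zero hK.index_ne_zero g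
      have h2 : η ((g ^ m)⁻¹ * k * g ^ m) = η k := by
        rw [hη _ (mul_mem (inv_mem hmem) hk) _ hmem, hη _ (inv_mem hmem) _ hk, hinv _ hmem]
        ring
      rw [hstep m] at h2
      have hm' : (m : ℝ) ≠ 0 := by positivity
      have h3 : η (k⁻¹ * g⁻¹ * k * g) = 0 := by
        have : (m : ℝ) * η (k⁻¹ * g⁻¹ * k * g) = 0 := by linarith
        exact (mul_eq_zero.1 this).resolve_left hm'
      have h4 : g⁻¹ * k * g = k * (k⁻¹ * g⁻¹ * k * g) := by group
      rw [h4, hη _ hk _ hcK, h3, add_zero]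
  exact key N 0 (by simp) g k hk (by simp)

/-- In a nilpotent group, homomorphisms to `ℝ` extend from normal subgroups of finite index. -/
theorem exists_isAdditive_extension [Group.IsNilpotent G] (K : Subgroup G) [K.Normal]
    [hK : K.FiniteIndex] (η : G → ℝ) (hη : ∀ a ∈ K, ∀ b ∈ K, η (a * b) = η a + η b) :
    ∃ h : G → ℝ, IsAdditive h ∧ ∀ k ∈ K, h k = η k := by
  have := Fintype.ofFinite (G ⧸ K)
  have hout : ∀ g : G, (g : G ⧸ K).out⁻¹ * g ∈ K := fun g => by
    rw [← QuotientGroup.eq, QuotientGroup.out_eq']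
  set E : G → ℝ := fun g => η ((g : G ⧸ K).out⁻¹ * g) with hE
  have hEk : ∀ g k : G, k ∈ K → E (g * k) = E g + η k := by
    intro g k hk
    have : ((g * k : G) : G ⧸ K) = g := by
      rw [QuotientGroup.eq]
      simpa using hk
    simp only [hE, this]
    rw [← mul_assoc, hη _ (hout g) _ hk]
  set n : ℝ := (Fintype.card (G ⧸ K) : ℝ) with hn
  have hn0 : n ≠ 0 := by
    have : 0 < Fintype.card (G ⧸ K) := Fintype.card_pos
    positivity
  -- A transfer argument: `E (g * x) - E x` depends only on the coset `x K`, so its average over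
  -- cosets is additive in `g`. For `g ∈ K`, conjugation invariance makes every summand equal to `η
  -- g`.
  refine ⟨fun g => (∑ q : G ⧸ K, (E (g * q.out) - E q.out)) / n, fun a b => ?_, fun k hk => ?_⟩
  · beta_reduce
    rw [← add_div]
    congr 1
    have hD : ∀ x : G, E (a * x) - E x = E (a * (x : G ⧸ K).out) - E (x : G ⧸ K).out := by
      intro x
      have hx : x = (x : G ⧸ K).out * ((x : G ⧸ K).out⁻¹ * x) := by group
      have h1 := hEk (x : G ⧸ K).out _ (hout x)
      have h2 := hEk (a * (x : G ⧸ K).out) _ (hout x)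
      rw [mul_assoc, ← hx] at h2
      rw [← hx] at h1
      linarith
    have hsum : ∑ q : G ⧸ K, (E (a * (b • q).out) - E (b • q).out) =
        ∑ q : G ⧸ K, (E (a * q.out) - E q.out) :=
      Equiv.sum_comp (MulAction.toPerm b) fun q : G ⧸ K => E (a * q.out) - E q.out
    rw [← hsum, ← Finset.sum_add_distrib]
    refine Finset.sum_congr rfl fun q _ => ?_
    have h3 := hD (b * q.out)
    have h4 : ((b * q.out : G) : G ⧸ K) = b • q := by
      conv_rhs => rw [← QuotientGroup.out_eq' q]
      rfl
    rw [h4] at h3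
    rw [← h3, mul_assoc]
    ring
  · have : ∀ q : G ⧸ K, E (k * q.out) - E q.out = η k := by
      intro q
      have h1 : k * q.out = q.out * (q.out⁻¹ * k * q.out) := by group
      have h2 : q.out⁻¹ * k * q.out ∈ K := by simpa using ‹K.Normal›.conj_mem k hk q.out⁻¹
      rw [h1, hEk _ _ h2, map_conj_of_additive_on K η hη _ _ hk]
      ring
    simp only [this, Finset.sum_const, Finset.card_univ, nsmul_eq_mul]
    rw [← hn]
    field_simp

/-- A finitely generated infinite abelian group has a non-zero homomorphism to `ℝ`. -/
theorem exists_isAdditive_ne_zero {A : Type*} [CommGroup A] [Group.FG A] (hA : Infinite A) :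
    ∃ h : A → ℝ, IsAdditive h ∧ ∃ a, h a ≠ 0 := by
  by_contra! hcon
  have : Module.Finite ℤ (Additive A) := Module.Finite.iff_addGroup_fg.2 inferInstance
  set T := Submodule.torsion ℤ (Additive A) with hT
  have : Module.Free ℤ (Additive A ⧸ T) := Module.free_of_finite_type_torsion_free'
  have htor : ∀ a : Additive A, a ∈ T := by
    intro a
    rw [← Submodule.Quotient.mk_eq_zero T]
    -- The coordinates of the free quotient are homomorphisms to `ℝ`, hence zero by assumption. So
    -- `A` is torsion and finitely generated, that is, finite.
    refine (Module.Free.chooseBasis ℤ (Additive A ⧸ T)).ext_elem fun i => ?_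
    have := hcon (fun x : A => ((Module.Free.chooseBasis ℤ (Additive A ⧸ T)).repr
      (Submodule.Quotient.mk (Additive.ofMul x)) i : ℝ)) (fun x y => by simp) a.toMul
    simpa using this
  have hfin : Finite (Additive A) := by
    exact Module.finite_of_fg_torsion _ fun x => (Submodule.mem_torsion_iff x).1 (htor x)
  exact hA.not_finite (Finite.of_equiv _ Additive.toMul)

end GroupTheory

end NilpotentHoro

namespace NilpotentHoro

section GroupTheory

/-- A subgroup of a finitely generated nilpotent group has finite index if it is not contained in
the kernel of a non-zero homomorphism to `ℝ`. -/
theorem finiteIndex_of_forall_isAdditive (G : Type*) [Group G] [Group.IsNilpotent G] :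
    Group.FG G → ∀ H : Subgroup G,
      (∀ h : G → ℝ, IsAdditive h → (∀ a ∈ H, h a = 0) → ∀ g, h g = 0) → H.FiniteIndex := by
  refine Group.nilpotent_center_quotient_ind
    (P := fun (G : Type _) _ _ => Group.FG G → ∀ H : Subgroup G,
      (∀ h : G → ℝ, IsAdditive h → (∀ a ∈ H, h a = 0) → ∀ g, h g = 0) → H.FiniteIndex) G ?_ ?_
  · intros
    infer_instance
  · intro G _ _ ih hG H hH
    set π := QuotientGroup.mk' (Subgroup.center G) with hπ
    have h1 : (H.map π).FiniteIndex := by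
      refine ih inferInstance _ fun h hh hv q => ?_
      obtain ⟨g, rfl⟩ := QuotientGroup.mk'_surjective _ q
      exact hH (fun g => h (π g)) (fun a b => by simp only [map_mul]; exact hh _ _)
        (fun a ha => hv _ (Subgroup.mem_map_of_mem π ha)) g
    set L := (H.map π).comap π with hL
    have hLfi : L.FiniteIndex :=
      ⟨by
        rw [hL, Subgroup.index_comap_of_surjective _ (QuotientGroup.mk'_surjective _)]
        exact h1.index_ne_zero⟩
    have hHL : H ≤ L := Subgroup.le_comap_map π H
    -- As `L = H Z(G)`, commutators of `L` are commutators of `H`. So `H` is normal in `L` with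
    -- abelian quotient, and an infinite quotient would carry a non-zero homomorphism.
    have hdec : ∀ l ∈ L, ∃ a ∈ H, ∃ z ∈ Subgroup.center G, l = a * z := by
      intro l hl
      obtain ⟨a, ha, hal⟩ := Subgroup.mem_map.1 (Subgroup.mem_comap.1 hl)
      exact ⟨a, ha, a⁻¹ * l, QuotientGroup.eq.1 hal, by group⟩
    have hcomm : ∀ l ∈ L, ∀ l' ∈ L, (l * l')⁻¹ * (l' * l) ∈ H := by
      intro l hl l' hl'
      obtain ⟨a, ha, z, hz, rfl⟩ := hdec l hl
      obtain ⟨b, hb, y, hy, rfl⟩ := hdec l' hl'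
      have e1 : a * z * (b * y) = a * b * (z * y) := by
        rw [mul_assoc, ← mul_assoc z, ← Subgroup.mem_center_iff.1 hz b]; group
      have e2 : b * y * (a * z) = b * a * (z * y) := by
        rw [mul_assoc, ← mul_assoc y, ← Subgroup.mem_center_iff.1 hy a,
          Subgroup.mem_center_iff.1 hy z]
        group
      have e3 : (a * z * (b * y))⁻¹ * (b * y * (a * z)) =
          (z * y)⁻¹ * ((a * b)⁻¹ * (b * a)) * (z * y) := by
        rw [e1, e2]; group
      rw [e3, mul_assoc, Subgroup.mem_center_iff.1 (mul_mem hz hy), inv_mul_cancel_left]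
      exact mul_mem (inv_mem (mul_mem ha hb)) (mul_mem hb ha)
    have hnorm : (H.subgroupOf L).Normal := by
      refine ⟨fun a ha l => ?_⟩
      rw [Subgroup.mem_subgroupOf] at ha ⊢
      have := hcomm (a : G) a.2 (l : G)⁻¹ (inv_mem l.2)
      have h2 := inv_mem this
      have h3 : ((l * a * l⁻¹ : L) : G) = a * ((a * (l : G)⁻¹)⁻¹ * ((l : G)⁻¹ * a))⁻¹ := by
        push_cast
        group
      rw [h3]
      exact mul_mem ha h2
    let _ : CommGroup (L ⧸ H.subgroupOf L) :=
      { (inferInstance : Group (L ⧸ H.subgroupOf L)) with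
        mul_comm := by
          intro a b
          obtain ⟨a, rfl⟩ := QuotientGroup.mk_surjective a
          obtain ⟨b, rfl⟩ := QuotientGroup.mk_surjective b
          refine QuotientGroup.eq.2 ?_
          rw [Subgroup.mem_subgroupOf]
          simpa using hcomm a a.2 b b.2 }
    by_contra hcon
    have hinf : Infinite (L ⧸ H.subgroupOf L) := by
      refine not_finite_iff_infinite.1 fun hf => hcon ?_
      have h2 : (H.subgroupOf L).FiniteIndex := Subgroup.finiteIndex_of_finite_quotient
      refine ⟨?_⟩
      rw [← Subgroup.relIndex_mul_index hHL]
      exact mul_ne_zero h2.index_ne_zero hLfi.index_ne_zero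
    obtain ⟨η₀, hη₀, a, ha⟩ := exists_isAdditive_ne_zero hinf
    classical
    set η : G → ℝ := fun g => if hg : g ∈ L then η₀ (QuotientGroup.mk ⟨g, hg⟩) else 0 with hη
    have hηL : ∀ l : L, η l = η₀ (QuotientGroup.mk l) := fun l => by simp [hη]
    have hKL : L.normalCore ≤ L := Subgroup.normalCore_le L
    -- The extension needs a normal subgroup, hence the normal core. Agreement on all of `L` is
    -- recovered in `hpow` by taking powers.
    obtain ⟨h, hh, hhη⟩ := exists_isAdditive_extension L.normalCore η (fun x hx y hy => by
      have h1 := hηL ⟨x, hKL hx⟩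
      have h2 := hηL ⟨y, hKL hy⟩
      have h3 := hηL (⟨x, hKL hx⟩ * ⟨y, hKL hy⟩)
      rw [QuotientGroup.mk_mul, hη₀] at h3
      simp only [Subgroup.coe_mul] at h1 h2 h3
      rw [h1, h2, h3])
    have hpow : ∀ l : L, h l = η₀ (QuotientGroup.mk l) := by
      intro l
      obtain ⟨m, hm, -, hmem⟩ :=
        Subgroup.exists_pow_mem_of_index_ne_zero (H := L.normalCore)
          Subgroup.FiniteIndex.index_ne_zero (l : G)
      have h1 := hhη _ hmem
      have h2 := hηL (l ^ m)
      rw [Subgroup.coe_pow] at h2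
      rw [hh.map_pow, h2, QuotientGroup.mk_pow, hη₀.map_pow] at h1
      exact mul_left_cancel₀ (by positivity) h1
    obtain ⟨l, rfl⟩ := QuotientGroup.mk_surjective a
    refine ha ?_
    rw [← hpow]
    refine hH h hh (fun b hb => ?_) l
    have h1 := hpow ⟨b, hHL hb⟩
    have h2 : (QuotientGroup.mk (⟨b, hHL hb⟩ : L) : L ⧸ H.subgroupOf L) = 1 :=
      (QuotientGroup.eq_one_iff _).2 (Subgroup.mem_subgroupOf.2 hb)
    rw [h2, hη₀.map_one] at h1
    exact h1

/-! ### Submonoids of nilpotent groups and facet words -/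

variable {G : Type*} [Group G]

/-- A nilpotent group satisfies the Ore condition with respect to every submonoid. -/
theorem exists_mul_eq_mul_of_mem [Group.IsNilpotent G] (M : Submonoid G) {a b : G}
    (ha : a ∈ M) (hb : b ∈ M) : ∃ p ∈ M, ∃ q ∈ M, a * p = b * q := by
  obtain ⟨N, hN⟩ := Subgroup.nilpotent_iff_lowerCentralSeries.1 ‹Group.IsNilpotent G›
  have key : ∀ n : ℕ, ∃ p ∈ M, ∃ q ∈ M,
      (a * p)⁻¹ * (b * q) ∈ (⊤ : Subgroup G).lowerCentralSeries n := by
    intro n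
    induction n with
    | zero => exact ⟨1, M.one_mem, 1, M.one_mem, by simp⟩
    | succ n ih =>
      obtain ⟨p, hp, q, hq, h⟩ := ih
      -- With `u = a * p` and `v = b * q`, the new discrepancy `(u * v)⁻¹ * (v * u)` is the
      -- commutator of the old one, `u⁻¹ * v`, with `u`.
      refine ⟨p * (b * q), mul_mem hp (mul_mem hb hq), q * (a * p), mul_mem hq (mul_mem ha hp), ?_⟩
      convert commutator_mem_lowerCentralSeries_succ h (a * p) using 1
      group
  obtain ⟨p, hp, q, hq, h⟩ := key N
  rw [hN, Subgroup.mem_bot, inv_mul_eq_one] at h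
  exact ⟨p, hp, q, hq, h⟩

theorem mem_subgroup_closure_of_mem_closure {V : Set G} {a : G} (ha : a ∈ Submonoid.closure V) :
    a ∈ Subgroup.closure V :=
  (Submonoid.closure_le (S := (Subgroup.closure V).toSubmonoid)).2 Subgroup.subset_closure ha

/-- In a nilpotent group, the elements of the subgroup generated by `V` are right fractions of
elements of the submonoid generated by `V`. -/
theorem exists_mul_eq_of_mem_closure [Group.IsNilpotent G] {V : Set G} {g : G}
    (hg : g ∈ Subgroup.closure V) :
    ∃ b ∈ Submonoid.closure V, g * b ∈ Submonoid.closure V := by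
  induction hg using Subgroup.closure_induction with
  | mem x hx => exact ⟨1, one_mem _, by simpa using Submonoid.subset_closure hx⟩
  | one => exact ⟨1, one_mem _, by simp⟩
  | mul x y _ _ hx hy =>
    obtain ⟨b, hb, hxb⟩ := hx
    obtain ⟨c, hc, hyc⟩ := hy
    obtain ⟨p, hp, q, hq, h⟩ := exists_mul_eq_mul_of_mem _ hb hyc
    refine ⟨c * q, mul_mem hc hq, ?_⟩
    rw [show x * y * (c * q) = x * (y * c * q) by group, ← h, ← mul_assoc]
    exact mul_mem hxb hp
  | inv x _ hx =>
    obtain ⟨b, hb, hxb⟩ := hx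
    exact ⟨x * b, hxb, by simpa using hb⟩

theorem SimpleCommutator.mem_closure {V : Set G} {c : G} (hc : SimpleCommutator V c) :
    c ∈ Subgroup.closure V := by
  induction hc with
  | base hs => exact Subgroup.subset_closure hs
  | step _ hs ih =>
    have := Subgroup.subset_closure hs
    exact mul_mem (mul_mem (mul_mem (inv_mem ih) (inv_mem this)) ih) this

/-- In a nilpotent group, a finite set has only finitely many simple commutators. -/
theorem finite_setOf_simpleCommutator [Group.IsNilpotent G] {V : Set G} (hV : V.Finite) :
    {c | SimpleCommutator V c}.Finite := by
  obtain ⟨N, hN⟩ := Subgroup.nilpotent_iff_lowerCentralSeries.1 ‹Group.IsNilpotent G›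
  let A : ℕ → Set G := fun n =>
    Nat.rec V (fun _ B => Set.image2 (fun c s => c⁻¹ * s⁻¹ * c * s) B V) n
  have hA1 : ∀ n, A (n + 1) = Set.image2 (fun c s => c⁻¹ * s⁻¹ * c * s) (A n) V := fun _ => rfl
  have hfin : ∀ n, (A n).Finite := by
    intro n
    induction n with
    | zero => exact hV
    | succ n ih => rw [hA1]; exact ih.image2 _ hV
  have hlcs : ∀ n, ∀ c ∈ A n, c ∈ (⊤ : Subgroup G).lowerCentralSeries n := by
    intro n
    induction n with
    | zero => simp
    | succ n ih =>
      rw [hA1]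
      rintro _ ⟨c, hc, s, -, rfl⟩
      exact commutator_mem_lowerCentralSeries_succ (ih c hc) s
  have hex : ∀ c, SimpleCommutator V c → ∃ n, c ∈ A n := by
    intro c hc
    induction hc with
    | base hs => exact ⟨0, hs⟩
    | step _ hs ih =>
      obtain ⟨n, hn⟩ := ih
      exact ⟨n + 1, by rw [hA1]; exact ⟨_, hn, _, hs, rfl⟩⟩
  refine (((Set.finite_Iio N).biUnion fun n _ => hfin n).union (Set.finite_singleton 1)).subset ?_
  intro c hc
  obtain ⟨n, hn⟩ := hex c hc
  by_cases hnN : n < N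
  · exact Or.inl (Set.mem_biUnion (Set.mem_Iio.2 hnN) hn)
  · refine Or.inr ?_
    have := Subgroup.lowerCentralSeries_antitone _ (not_lt.1 hnN) (hlcs n c hn)
    rw [hN] at this
    exact this

/-- There are finitely many simple commutators, and each is a fraction of two elements of the monoid
of `V`. Concatenating words for all numerators and denominators gives `w`. -/
theorem exists_isFacetWord [Group.IsNilpotent G] {V : Set G} (hV : V.Finite) :
    ∃ w : List G, IsFacetWord V w := by
  suffices ∀ C : Set G, C.Finite → C ⊆ Subgroup.closure V → ∃ w : List G, (∀ s ∈ w, s ∈ V) ∧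
      ∀ c ∈ C, ∃ x y : List G, x <:+: w ∧ y <:+: w ∧ c * x.prod = y.prod from
    this _ (finite_setOf_simpleCommutator hV) fun c hc => SimpleCommutator.mem_closure hc
  intro C hC
  induction C, hC using Set.Finite.induction_on with
  | empty => exact fun _ => ⟨[], by simp, by simp⟩
  | @insert c C _ _ ih =>
    intro hCV
    obtain ⟨w, hw, hwC⟩ := ih ((Set.subset_insert _ _).trans hCV)
    obtain ⟨b, hb, hcb⟩ := exists_mul_eq_of_mem_closure (hCV (Set.mem_insert _ _))
    obtain ⟨x, hx, rfl⟩ := Submonoid.exists_list_of_mem_closure hb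
    obtain ⟨y, hy, hyc⟩ := Submonoid.exists_list_of_mem_closure hcb
    refine ⟨w ++ x ++ y, ?_, ?_⟩
    · intro s hs
      simp only [List.mem_append] at hs
      rcases hs with (hs | hs) | hs
      exacts [hw s hs, hx s hs, hy s hs]
    · rintro d (rfl | hd)
      · exact ⟨x, y, ⟨w, y, rfl⟩, ⟨w ++ x, [], by simp⟩, hyc.symm⟩
      · obtain ⟨x', y', hx', hy', h⟩ := hwC d hd
        have hpre : w <:+: w ++ x ++ y := ⟨[], x ++ y, by simp⟩
        exact ⟨x', y', hx'.trans hpre, hy'.trans hpre, h⟩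

theorem prod_mem_closure {V : Set G} {l w : List G} (hw : ∀ s ∈ w, s ∈ V) (hl : l <:+: w) :
    l.prod ∈ Submonoid.closure V :=
  Submonoid.list_prod_mem _ fun s hs => Submonoid.subset_closure (hw s (hl.subset hs))

/-- The elements all of whose conjugates under `H`, together with those of their inverses, are
moved into the submonoid `M` of `H` by some power of `p`. -/
def absorbedSubgroup (H : Subgroup G) (M : Submonoid G) (hM : M ≤ H.toSubmonoid) (p : G) :
    Subgroup G where
  carrier := {g | ∀ a ∈ H, (∃ n : ℕ, a⁻¹ * g * a * p ^ n ∈ M) ∧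
    ∃ n : ℕ, a⁻¹ * g⁻¹ * a * p ^ n ∈ M}
  one_mem' := fun a _ => ⟨⟨0, by simp⟩, ⟨0, by simp⟩⟩
  inv_mem' := fun {g} hg a ha => ⟨(hg a ha).2, by simpa using (hg a ha).1⟩
  mul_mem' := by
    have key : ∀ g g' : G, (∀ a ∈ H, ∃ n : ℕ, a⁻¹ * g * a * p ^ n ∈ M) →
        (∀ a ∈ H, ∃ n : ℕ, a⁻¹ * g' * a * p ^ n ∈ M) →
        ∀ a ∈ H, ∃ n : ℕ, a⁻¹ * (g * g') * a * p ^ n ∈ M := by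
      intro g g' hg hg' a ha
      obtain ⟨n, hn⟩ := hg' a ha
      -- With `b = g' * a * p ^ n`, the target is `(a⁻¹ * g' * a * p ^ n) * (b⁻¹ * g * b * p ^ k)`.
      -- This is why the carrier asks for all conjugates under `H`.
      obtain ⟨k, hk⟩ := hg (a * (a⁻¹ * g' * a * p ^ n)) (mul_mem ha (hM hn))
      refine ⟨n + k, ?_⟩
      convert mul_mem hn hk using 1
      rw [pow_add]
      group
    intro g g' hg hg' a ha
    refine ⟨key g g' (fun b hb => (hg b hb).1) (fun b hb => (hg' b hb).1) a ha, ?_⟩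
    rw [mul_inv_rev]
    exact key g'⁻¹ g⁻¹ (fun b hb => (hg' b hb).2) (fun b hb => (hg b hb).2) a ha

theorem conj_mem_absorbedSubgroup {H : Subgroup G} {M : Submonoid G} {hM : M ≤ H.toSubmonoid}
    {p g a : G} (hg : g ∈ absorbedSubgroup H M hM p) (ha : a ∈ H) :
    a⁻¹ * g * a ∈ absorbedSubgroup H M hM p := by
  intro b hb
  have := hg (a * b) (mul_mem ha hb)
  simpa [mul_assoc] using this

/-- Every element of the subgroup generated by `V` becomes a product of elements of `V` after
multiplication by a large power of a facet word. -/
theorem IsFacetWord.exists_mul_pow_mem [Group.IsNilpotent G] {V : Set G} {w : List G}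
    (hw : IsFacetWord V w) {g : G} (hg : g ∈ Subgroup.closure V) :
    ∃ n : ℕ, g * w.prod ^ n ∈ Submonoid.closure V := by
  obtain ⟨N, hN⟩ := Subgroup.nilpotent_iff_lowerCentralSeries.1 ‹Group.IsNilpotent G›
  set H := Subgroup.closure V with hH
  set M := Submonoid.closure V with hMdef
  have hM : M ≤ H.toSubmonoid := fun a ha => mem_subgroup_closure_of_mem_closure ha
  set A := absorbedSubgroup H M hM w.prod with hA
  have hAM : ∀ g ∈ A, ∃ n : ℕ, g * w.prod ^ n ∈ M := fun g hg => by
    simpa using (hg 1 (one_mem _)).1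
  -- Write `w = w₁ x w₂`. Moving `d` past `w₁` costs an element of `A`, and `d x = y` then turns one
  -- copy of `w` into `w₁ y w₂ ∈ M`. The error, pushed to the right, stays in `A` and is absorbed by
  -- further copies of `w`.
  have hmove : ∀ d : G, (∀ a ∈ H, d⁻¹ * a⁻¹ * d * a ∈ A) → ∀ x y : List G, x <:+: w → y <:+: w →
      d * x.prod = y.prod → ∀ m ∈ A, ∃ n : ℕ, d * m * w.prod ^ n ∈ M := by
    rintro d hd x y ⟨w₁, w₂, hxw⟩ hy hxy m hm
    have hw₁ : w₁.prod ∈ H := hM (prod_mem_closure hw.1 ⟨[], x ++ w₂, by simpa using hxw⟩)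
    have hx : x.prod ∈ H := hM (prod_mem_closure hw.1 ⟨w₁, w₂, hxw⟩)
    have hw₂ : w₂.prod ∈ H := hM (prod_mem_closure hw.1 ⟨w₁ ++ x, [], by simpa using hxw⟩)
    have hwp : w.prod = w₁.prod * x.prod * w₂.prod := by rw [← hxw]; simp [mul_assoc]
    have hm' := conj_mem_absorbedSubgroup (mul_mem (hd _ hw₁) (conj_mem_absorbedSubgroup hm hw₁))
      (mul_mem hx hw₂)
    obtain ⟨n, hn⟩ := hAM _ hm'
    refine ⟨1 + n, ?_⟩
    have h1 : w₁.prod * y.prod * w₂.prod ∈ M :=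
      mul_mem (mul_mem (prod_mem_closure hw.1 ⟨[], x ++ w₂, by simpa using hxw⟩)
        (prod_mem_closure hw.1 hy))
        (prod_mem_closure hw.1 ⟨w₁ ++ x, [], by simpa using hxw⟩)
    convert mul_mem h1 hn using 1
    rw [← hxy, pow_add, pow_one]
    nth_rewrite 1 [hwp]
    group
  have hcent : ∀ c ∈ H, (∀ s ∈ V, c⁻¹ * s⁻¹ * c * s ∈ A) → ∀ a ∈ H, c⁻¹ * a⁻¹ * c * a ∈ A := by
    intro c _ hcV a ha
    induction ha using Subgroup.closure_induction with
    | mem s hs => exact hcV s hs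
    | one => simp
    | mul x y _ hy ihx ihy =>
      convert mul_mem ihy (conj_mem_absorbedSubgroup ihx hy) using 1
      group
    | inv x hx ih =>
      convert conj_mem_absorbedSubgroup (inv_mem ih) (inv_mem hx) using 1
      group
  -- Descending induction along the lower central series: the commutators of `c` with letters of `V`
  -- are already in `A`, hence by `hcent` so are those with all of `H`, and `hmove` applies. For
  -- `c⁻¹` the words `x` and `y` swap roles.
  have hmain : ∀ j i : ℕ, i + j = N → ∀ c, SimpleCommutator V c →
      c ∈ (⊤ : Subgroup G).lowerCentralSeries i → c ∈ A := by
    intro j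
    induction j with
    | zero =>
      intro i hi c _ hci
      rw [add_zero] at hi
      rw [hi, hN, Subgroup.mem_bot] at hci
      rw [hci]
      exact one_mem _
    | succ j ih =>
      intro i hi c hc hci
      have hcH := hc.mem_closure
      have hcA := hcent c hcH fun s hs => ih (i + 1) (by omega) _ (hc.step hs)
        (commutator_mem_lowerCentralSeries_succ hci s)
      have hcA' : ∀ a ∈ H, c⁻¹⁻¹ * a⁻¹ * c⁻¹ * a ∈ A := by
        intro a ha
        convert conj_mem_absorbedSubgroup (inv_mem (hcA a ha)) (inv_mem hcH) using 1
        group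
      obtain ⟨x, y, hx, hy, hxy⟩ := hw.2 c hc
      intro a ha
      constructor
      · have := hmove c hcA x y hx hy hxy _ (hcA a ha)
        convert this using 4
        group
      · have := hmove c⁻¹ hcA' y x hy hx (by rw [← hxy]; group) _ (hcA' a ha)
        convert this using 4
        group
  have hVA : H ≤ A := (Subgroup.closure_le _).2 fun s hs =>
    hmain N 0 (by simp) s (SimpleCommutator.base hs) (by simp)
  exact hAM g (hVA hg)

end GroupTheory

end NilpotentHoro

/-! ### Word metric, geodesic paths and Busemann functions -/

namespace NilpotentHoro

variable {G : Type*} [Group G] {S : Set G}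

section WordDist

theorem connected_mulCayley (hgen : Subgroup.closure S = ⊤) :
    (SimpleGraph.mulCayley S).Connected := by
  have key : ∀ g ∈ Subgroup.closure S, ∀ u : G,
      (SimpleGraph.mulCayley S).Reachable u (u * g) := by
    intro g hg
    induction hg using Subgroup.closure_induction with
    | mem s hs =>
      intro u
      by_cases hu : u = u * s
      · rw [← hu]
      · exact SimpleGraph.Adj.reachable
          ((SimpleGraph.mulCayley_adj' S _ _).2 ⟨hu, s, hs, Or.inl rfl⟩)
    | one => simp
    | mul x y _ _ hx hy =>
      intro u
      have := (hx u).trans (hy (u * x))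
      rwa [mul_assoc] at this
    | inv x _ hx =>
      intro u
      simpa using (hx (u * x⁻¹)).symm
  have : Nonempty G := ⟨1⟩
  refine ⟨fun u v => ?_⟩
  simpa using key (u⁻¹ * v) (by rw [hgen]; trivial) u

theorem exists_mem_of_adj (hsymm : ∀ s ∈ S, s⁻¹ ∈ S) {u v : G}
    (h : (SimpleGraph.mulCayley S).Adj u v) : u⁻¹ * v ∈ S := by
  obtain ⟨-, s, hs, rfl | rfl⟩ := (SimpleGraph.mulCayley_adj' S _ _).1 h
  · simpa using hs
  · simpa using hsymm s hs

theorem wordDist_self (u : G) : wordDist S u u = 0 :=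
  SimpleGraph.dist_self

theorem wordDist_comm (u v : G) : wordDist S u v = wordDist S v u :=
  SimpleGraph.dist_comm

theorem wordDist_triangle (hgen : Subgroup.closure S = ⊤) (u v w : G) :
    wordDist S u w ≤ wordDist S u v + wordDist S v w :=
  (connected_mulCayley hgen).dist_triangle

theorem wordDist_mul_le_one {s : G} (hs : s ∈ S) (u : G) : wordDist S u (u * s) ≤ 1 := by
  by_cases hu : u = u * s
  · rw [← hu, wordDist_self]
    exact zero_le_one
  · exact (SimpleGraph.dist_eq_one_iff_adj.2
      ((SimpleGraph.mulCayley_adj' S _ _).2 ⟨hu, s, hs, Or.inl rfl⟩)).le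

theorem wordDist_mul_pow_le (hgen : Subgroup.closure S = ⊤) {s : G} (hs : s ∈ S) (u : G) (n : ℕ) :
    wordDist S u (u * s ^ n) ≤ n := by
  induction n with
  | zero => simp [wordDist_self]
  | succ n ih =>
    have h1 := wordDist_triangle hgen u (u * s ^ n) (u * s ^ n * s)
    have h2 := wordDist_mul_le_one hs (u * s ^ n)
    rw [pow_succ, ← mul_assoc]
    omega

/-- The generators on which `h` takes the value `1`. -/
def tightGenerators (S : Set G) (h : G → ℝ) : Set G :=
  {s ∈ S | h s = 1}

variable {h : G → ℝ}

/-- Each step of a shortest path raises `h` by at most `1`, so equality forces every step to be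
tight. -/
theorem sub_le_wordDist_and_mem (hgen : Subgroup.closure S = ⊤) (hsymm : ∀ s ∈ S, s⁻¹ ∈ S)
    (hh : IsAdditive h) (hle : ∀ s ∈ S, h s ≤ 1) (u v : G) :
    h v - h u ≤ wordDist S u v ∧
      (h v - h u = wordDist S u v → u⁻¹ * v ∈ Submonoid.closure (tightGenerators S h)) := by
  obtain ⟨p, hp⟩ := (connected_mulCayley hgen).exists_walk_length_eq_dist u v
  have key : ∀ (u v : G) (p : (SimpleGraph.mulCayley S).Walk u v), h v - h u ≤ p.length ∧
      (h v - h u = p.length → u⁻¹ * v ∈ Submonoid.closure (tightGenerators S h)) := by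
    intro u v p
    induction p with
    | nil => simp
    | @cons u x v hadj p ih =>
      have hs := exists_mem_of_adj hsymm hadj
      have h1 := hle _ hs
      have h2 : h (u⁻¹ * x) = h x - h u := by rw [hh, hh.map_inv]; ring
      rw [SimpleGraph.Walk.length_cons]
      push_cast
      refine ⟨by linarith [ih.1], fun he => ?_⟩
      have h3 : h (u⁻¹ * x) = 1 := by linarith [ih.1]
      have h4 := mul_mem (Submonoid.subset_closure (s := tightGenerators S h) ⟨hs, h3⟩)
        (ih.2 (by linarith [ih.1]))
      simpa [mul_assoc] using h4
  have := key u v p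
  rwa [hp] at this

theorem sub_le_wordDist (hgen : Subgroup.closure S = ⊤) (hsymm : ∀ s ∈ S, s⁻¹ ∈ S)
    (hh : IsAdditive h) (hle : ∀ s ∈ S, h s ≤ 1) (u v : G) : h v - h u ≤ wordDist S u v :=
  (sub_le_wordDist_and_mem hgen hsymm hh hle u v).1

theorem wordDist_eq_sub (hgen : Subgroup.closure S = ⊤) (hsymm : ∀ s ∈ S, s⁻¹ ∈ S)
    (hh : IsAdditive h) (hle : ∀ s ∈ S, h s ≤ 1) {u v : G}
    (huv : u⁻¹ * v ∈ Submonoid.closure (tightGenerators S h)) :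
    (wordDist S u v : ℝ) = h v - h u := by
  refine le_antisymm ?_ (sub_le_wordDist hgen hsymm hh hle u v)
  have key : ∀ m ∈ Submonoid.closure (tightGenerators S h), ∀ u : G,
      (wordDist S u (u * m) : ℝ) ≤ h m := by
    intro m hm
    induction hm using Submonoid.closure_induction with
    | mem s hs =>
      intro u
      rw [hs.2]
      exact_mod_cast wordDist_mul_le_one hs.1 u
    | one => simp [wordDist_self, hh.map_one]
    | mul x y _ _ hx hy =>
      intro u
      have h1 : (wordDist S u (u * x * y) : ℝ) ≤
          wordDist S u (u * x) + wordDist S (u * x) (u * x * y) :=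
        mod_cast wordDist_triangle hgen _ _ _
      rw [hh, ← mul_assoc]
      linarith [hx u, hy (u * x)]
  have := key _ huv u
  rwa [mul_inv_cancel_left, hh, hh.map_inv, neg_add_eq_sub] at this

end WordDist

section Geodesic

variable {γ : ℕ → G}

theorem IsGeodesicPath.wordDist_add (hγ : IsGeodesicPath S γ) (m k : ℕ) :
    wordDist S (γ m) (γ (m + k)) = k := by
  have := hγ m (m + k)
  push_cast at this
  rw [show (m : ℤ) - (m + k) = -k by ring, abs_neg, Nat.abs_cast] at this
  exact_mod_cast this

theorem isGeodesicPath_of_wordDist_add (hγ : ∀ m k, wordDist S (γ m) (γ (m + k)) = k) :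
    IsGeodesicPath S γ := by
  intro m n
  rcases le_total m n with h | h
  · obtain ⟨k, rfl⟩ := Nat.exists_eq_add_of_le h
    rw [hγ]
    push_cast
    rw [show (m : ℤ) - (m + k) = -k by ring, abs_neg, Nat.abs_cast]
  · obtain ⟨k, rfl⟩ := Nat.exists_eq_add_of_le h
    rw [wordDist_comm, hγ]
    push_cast
    rw [show (n + k : ℤ) - n = k by ring, Nat.abs_cast]

theorem IsGeodesicPath.step_mem (hsymm : ∀ s ∈ S, s⁻¹ ∈ S) (hγ : IsGeodesicPath S γ) (n : ℕ) :
    (γ n)⁻¹ * γ (n + 1) ∈ S :=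
  exists_mem_of_adj hsymm (SimpleGraph.dist_eq_one_iff_adj.1 (hγ.wordDist_add n 1))

/-- `b` is the Busemann function of `γ`: the eventual value of `d(x, γ n) - n`. -/
def IsBusemannFunction (S : Set G) (γ : ℕ → G) (b : G → ℝ) : Prop :=
  ∀ x, ∀ᶠ n : ℕ in atTop, (wordDist S x (γ n) : ℝ) = n + b x

theorem IsGeodesicPath.exists_isBusemannFunction (hgen : Subgroup.closure S = ⊤)
    (hγ : IsGeodesicPath S γ) : ∃ b, IsBusemannFunction S γ b := by
  suffices ∀ x, ∃ b : ℝ, ∀ᶠ n : ℕ in atTop, (wordDist S x (γ n) : ℝ) = n + b by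
    choose b hb using this
    exact ⟨b, hb⟩
  intro x
  -- By the triangle inequality the subtraction never truncates. The sequence is non-increasing in
  -- `ℕ`, hence constant from a minimiser on.
  let c : ℕ → ℕ := fun n => wordDist S (γ 0) x + wordDist S x (γ n) - n
  have hc : ∀ n, c n + n = wordDist S (γ 0) x + wordDist S x (γ n) := by
    intro n
    have h1 := wordDist_triangle hgen (γ 0) x (γ n)
    have h2 := hγ.wordDist_add 0 n
    rw [zero_add] at h2
    simp only [c]
    omega
  have hanti : ∀ n k, c (n + k) ≤ c n := by
    intro n k
    have h1 := wordDist_triangle hgen x (γ n) (γ (n + k))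
    have h2 := hγ.wordDist_add n k
    have h3 := hc n
    have h4 := hc (n + k)
    omega
  set n₀ := Function.argmin c
  refine ⟨(c n₀ : ℝ) - wordDist S (γ 0) x, ?_⟩
  filter_upwards [eventually_ge_atTop n₀] with n hn
  obtain ⟨k, rfl⟩ := Nat.exists_eq_add_of_le hn
  have h1 : c (n₀ + k) = c n₀ := le_antisymm (hanti _ _) (Function.argmin_le c _)
  have h2 := hc (n₀ + k)
  rw [h1] at h2
  have h3 : (c n₀ : ℝ) + (n₀ + k : ℕ) = wordDist S (γ 0) x + wordDist S x (γ (n₀ + k)) := by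
    exact_mod_cast h2
  linarith

namespace IsBusemannFunction

variable {b : G → ℝ}

theorem tendsto (hb : IsBusemannFunction S γ b) :
    Tendsto (fun n => psi S (γ n)) atTop (𝓝 fun x => b x - b 1) := by
  refine tendsto_pi_nhds.2 fun x => tendsto_const_nhds.congr' ?_
  filter_upwards [hb x, hb 1] with n h1 h2
  rw [psi, h1, h2]
  ring

theorem apply_eq (hb : IsBusemannFunction S γ b) {ξ : horoBoundary S} (hξ : ConvergesTo S γ ξ)
    (x : G) : ξ.1 x = b x - b 1 :=
  congrFun (tendsto_nhds_unique hξ hb.tendsto) x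

theorem apply_path (hγ : IsGeodesicPath S γ) (hb : IsBusemannFunction S γ b) (m : ℕ) :
    b (γ m) = -m := by
  obtain ⟨n, h1, hmn⟩ := ((hb (γ m)).and (eventually_ge_atTop m)).exists
  obtain ⟨k, rfl⟩ := Nat.exists_eq_add_of_le hmn
  rw [hγ.wordDist_add] at h1
  push_cast at h1
  linarith

theorem abs_sub_le (hgen : Subgroup.closure S = ⊤) (hb : IsBusemannFunction S γ b) (x y : G) :
    |b x - b y| ≤ wordDist S x y := by
  obtain ⟨n, h1, h2⟩ := ((hb x).and (hb y)).exists
  have h3 : (wordDist S x (γ n) : ℝ) ≤ wordDist S x y + wordDist S y (γ n) :=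
    mod_cast wordDist_triangle hgen _ _ _
  have h4 : (wordDist S y (γ n) : ℝ) ≤ wordDist S y x + wordDist S x (γ n) :=
    mod_cast wordDist_triangle hgen _ _ _
  rw [wordDist_comm y x] at h4
  rw [abs_le]
  constructor <;> linarith

end IsBusemannFunction

/-- Every geodesic path converges to a point of the horofunction boundary. -/
theorem IsGeodesicPath.exists_convergesTo (hgen : Subgroup.closure S = ⊤)
    (hγ : IsGeodesicPath S γ) : ∃ ξ : horoBoundary S, ConvergesTo S γ ξ := by
  obtain ⟨b, hb⟩ := hγ.exists_isBusemannFunction hgen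
  refine ⟨⟨fun x => b x - b 1, ?_, ?_⟩, hb.tendsto⟩
  · exact mem_closure_of_tendsto hb.tendsto (Eventually.of_forall fun n => ⟨_, rfl⟩)
  · rintro ⟨z, hz⟩
    -- The limit tends to `-∞` along `γ`, whereas `psi S z` is bounded below by `-wordDist S 1 z`.
    obtain ⟨m, hm⟩ := exists_nat_gt ((wordDist S 1 z : ℝ) - b 1)
    have h1 := congrFun hz (γ m)
    simp only [psi, hb.apply_path hγ] at h1
    have h2 : (0 : ℝ) ≤ wordDist S (γ m) z := Nat.cast_nonneg _
    linarith

theorem smul_apply (g : G) (ξ : horoBoundary S) (x : G) :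
    (g • ξ).1 x = ξ.1 (g⁻¹ * x) - ξ.1 (g⁻¹ * 1) :=
  rfl

theorem ConvergesTo.smul {ξ : horoBoundary S} (hξ : ConvergesTo S γ ξ) (g : G) :
    ConvergesTo S (fun n => g * γ n) (g • ξ) := by
  have := ((continuous_translate g).tendsto ξ.1).comp hξ
  simp only [Function.comp_def, translate_psi] at this
  exact this

theorem ConvergesTo.shift {ξ : horoBoundary S} (hξ : ConvergesTo S γ ξ) (k : ℕ) :
    ConvergesTo S (fun n => γ (k + n)) ξ := by
  simp only [add_comm k]
  exact (tendsto_add_atTop_iff_nat k).2 hξ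

theorem apply_mul_of_smul_eq {ξ : horoBoundary S} {k : G} (hk : k • ξ = ξ) (x : G) :
    ξ.1 (k * x) = ξ.1 k + ξ.1 x := by
  have hk' : k⁻¹ • ξ = ξ := by rw [inv_smul_eq_iff, hk]
  have := smul_apply k⁻¹ ξ x
  rw [hk', inv_inv, mul_one] at this
  linarith

end Geodesic

/-! ### Facet homomorphisms, facet rays and their limits -/

/-- Homomorphisms to `ℝ` that are at most `1` on the generators and take the value `1` on
sufficiently many of them to generate a subgroup of finite index. -/
structure IsFacetHom (S : Set G) (h : G → ℝ) : Prop where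
  additive : IsAdditive h
  le_one : ∀ s ∈ S, h s ≤ 1
  finiteIndex : (Subgroup.closure (tightGenerators S h)).FiniteIndex
  -- This excludes `h = 0` on a finite group, where the trivial subgroup has finite index although
  -- no facet exists.
  nonempty : (tightGenerators S h).Nonempty

/-- A path in the subgroup generated by the generators on which `h` is `1`, all of whose steps are
among these generators, that can be reached from everywhere in this subgroup by such steps. -/
structure IsFacetRay (S : Set G) (h : G → ℝ) (γ : ℕ → G) : Prop where
  mem : ∀ n, γ n ∈ Subgroup.closure (tightGenerators S h)
  step : ∀ n, (γ n)⁻¹ * γ (n + 1) ∈ tightGenerators S h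
  absorb : ∀ v ∈ Subgroup.closure (tightGenerators S h),
    ∃ n, v⁻¹ * γ n ∈ Submonoid.closure (tightGenerators S h)

theorem inv_mul_mem_closure_of_step {V : Set G} {γ : ℕ → G}
    (hstep : ∀ n, (γ n)⁻¹ * γ (n + 1) ∈ V) (m k : ℕ) :
    (γ m)⁻¹ * γ (m + k) ∈ Submonoid.closure V := by
  induction k with
  | zero => simp
  | succ k ih =>
    have := mul_mem ih (Submonoid.subset_closure (hstep (m + k)))
    simpa [mul_assoc, add_assoc] using this

theorem map_path_of_step {h : G → ℝ} (hh : IsAdditive h) {γ : ℕ → G}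
    (hstep : ∀ n, h ((γ n)⁻¹ * γ (n + 1)) = 1) (n : ℕ) : h (γ n) = n + h (γ 0) := by
  induction n with
  | zero => simp
  | succ n ih =>
    have := hstep n
    rw [hh, hh.map_inv] at this
    push_cast
    linarith

namespace IsFacetRay

variable {h : G → ℝ} {γ γ' : ℕ → G}

theorem map_path (hγ : IsFacetRay S h γ) (hh : IsAdditive h) (n : ℕ) :
    h (γ n) = n + h (γ 0) :=
  map_path_of_step hh (fun n => (hγ.step n).2) n

theorem eventually_mem (hγ : IsFacetRay S h γ) {v : G}
    (hv : v ∈ Subgroup.closure (tightGenerators S h)) :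
    ∀ᶠ n in atTop, v⁻¹ * γ n ∈ Submonoid.closure (tightGenerators S h) := by
  obtain ⟨m, hm⟩ := hγ.absorb v hv
  filter_upwards [eventually_ge_atTop m] with n hn
  obtain ⟨k, rfl⟩ := Nat.exists_eq_add_of_le hn
  simpa [mul_assoc] using mul_mem hm (inv_mul_mem_closure_of_step hγ.step m k)

theorem isGeodesicPath (hgen : Subgroup.closure S = ⊤) (hsymm : ∀ s ∈ S, s⁻¹ ∈ S)
    (hh : IsFacetHom S h) (hγ : IsFacetRay S h γ) : IsGeodesicPath S γ := by
  refine isGeodesicPath_of_wordDist_add fun m k => ?_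
  have := wordDist_eq_sub hgen hsymm hh.additive hh.le_one
    (inv_mul_mem_closure_of_step hγ.step m k)
  rw [hγ.map_path hh.additive, hγ.map_path hh.additive m] at this
  push_cast at this
  have h2 : (wordDist S (γ m) (γ (m + k)) : ℝ) = k := by linarith
  exact_mod_cast h2

theorem mul_left (hγ : IsFacetRay S h γ) {k : G}
    (hk : k ∈ Subgroup.closure (tightGenerators S h)) : IsFacetRay S h fun n => k * γ n where
  mem n := mul_mem hk (hγ.mem n)
  step n := by simpa [mul_assoc] using hγ.step n
  absorb v hv := by
    obtain ⟨n, hn⟩ := hγ.absorb (k⁻¹ * v) (mul_mem (inv_mem hk) hv)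
    exact ⟨n, by simpa [mul_assoc] using hn⟩

/-- A detour from `x` through `γ m` reaches late points of `γ'`, and its second leg has length
exactly the increment of `h` by absorption. By symmetry the two Busemann functions differ by a
constant. -/
theorem busemann_le (hgen : Subgroup.closure S = ⊤) (hsymm : ∀ s ∈ S, s⁻¹ ∈ S)
    (hh : IsFacetHom S h) (hγ : IsFacetRay S h γ) (hγ' : IsFacetRay S h γ') {b b' : G → ℝ}
    (hb : IsBusemannFunction S γ b) (hb' : IsBusemannFunction S γ' b') (x : G) :
    b' x ≤ b x + h (γ' 0) - h (γ 0) := by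
  obtain ⟨m, hm⟩ := (hb x).exists
  obtain ⟨n, hn, hmn⟩ := ((hb' x).and (hγ'.eventually_mem (hγ.mem m))).exists
  have h1 := wordDist_eq_sub hgen hsymm hh.additive hh.le_one hmn
  rw [hγ.map_path hh.additive, hγ'.map_path hh.additive] at h1
  have h2 : (wordDist S x (γ' n) : ℝ) ≤ wordDist S x (γ m) + wordDist S (γ m) (γ' n) :=
    mod_cast wordDist_triangle hgen _ _ _
  linarith

/-- All facet rays of a homomorphism converge to the same point. -/
theorem limit_unique (hgen : Subgroup.closure S = ⊤) (hsymm : ∀ s ∈ S, s⁻¹ ∈ S)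
    (hh : IsFacetHom S h) (hγ : IsFacetRay S h γ) (hγ' : IsFacetRay S h γ') {ξ ξ' : horoBoundary S}
    (hξ : ConvergesTo S γ ξ) (hξ' : ConvergesTo S γ' ξ') : ξ = ξ' := by
  obtain ⟨b, hb⟩ := (hγ.isGeodesicPath hgen hsymm hh).exists_isBusemannFunction hgen
  obtain ⟨b', hb'⟩ := (hγ'.isGeodesicPath hgen hsymm hh).exists_isBusemannFunction hgen
  refine Subtype.ext (funext fun x => ?_)
  rw [hb.apply_eq hξ, hb'.apply_eq hξ']
  have h1 := hγ.busemann_le hgen hsymm hh hγ' hb hb'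
  have h2 := hγ'.busemann_le hgen hsymm hh hγ hb' hb
  linarith [h1 x, h1 1, h2 x, h2 1]

/-- The translate of a facet ray by `k` is again a facet ray of `h`, so it has the same limit. -/
theorem smul_limit (hgen : Subgroup.closure S = ⊤) (hsymm : ∀ s ∈ S, s⁻¹ ∈ S)
    (hh : IsFacetHom S h) (hγ : IsFacetRay S h γ) {ξ : horoBoundary S}
    (hξ : ConvergesTo S γ ξ) {k : G} (hk : k ∈ Subgroup.closure (tightGenerators S h)) :
    k • ξ = ξ :=
  (hγ.mul_left hk).limit_unique hgen hsymm hh hγ (hξ.smul k) hξ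

theorem orbit_finite (hgen : Subgroup.closure S = ⊤) (hsymm : ∀ s ∈ S, s⁻¹ ∈ S)
    (hh : IsFacetHom S h) (hγ : IsFacetRay S h γ) {ξ : horoBoundary S}
    (hξ : ConvergesTo S γ ξ) : (MulAction.orbit G ξ).Finite := by
  have := hh.finiteIndex
  have h1 : (MulAction.stabilizer G ξ).FiniteIndex :=
    Subgroup.finiteIndex_of_le fun k hk =>
      MulAction.mem_stabilizer_iff.2 (hγ.smul_limit hgen hsymm hh hξ hk)
  refine Set.finite_of_ncard_ne_zero ?_
  rw [← MulAction.index_stabilizer]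
  exact h1.index_ne_zero

theorem limit_apply (hgen : Subgroup.closure S = ⊤) (hsymm : ∀ s ∈ S, s⁻¹ ∈ S)
    (hh : IsFacetHom S h) (hγ : IsFacetRay S h γ) {ξ : horoBoundary S}
    (hξ : ConvergesTo S γ ξ) {k : G} (hk : k ∈ Subgroup.closure (tightGenerators S h)) :
    ξ.1 k = -h k := by
  obtain ⟨b, hb⟩ := (hγ.isGeodesicPath hgen hsymm hh).exists_isBusemannFunction hgen
  have key : ∀ k ∈ Subgroup.closure (tightGenerators S h), b k = h (γ 0) - h k := by
    intro k hk
    obtain ⟨n, hn, hkn⟩ := ((hb k).and (hγ.eventually_mem hk)).exists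
    rw [wordDist_eq_sub hgen hsymm hh.additive hh.le_one hkn, hγ.map_path hh.additive] at hn
    linarith
  rw [hb.apply_eq hξ, key k hk, key 1 (one_mem _), hh.additive.map_one]
  ring

end IsFacetRay

/-- The limits of facet rays of different homomorphisms lie in different orbits. -/
theorem IsFacetHom.eq_of_limits_mem_orbit (hgen : Subgroup.closure S = ⊤)
    (hsymm : ∀ s ∈ S, s⁻¹ ∈ S) {h h' : G → ℝ} (hh : IsFacetHom S h) (hh' : IsFacetHom S h')
    {γ γ' : ℕ → G} (hγ : IsFacetRay S h γ) (hγ' : IsFacetRay S h' γ') {ξ ξ' : horoBoundary S}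
    (hξ : ConvergesTo S γ ξ) (hξ' : ConvergesTo S γ' ξ') (ho : ξ' ∈ MulAction.orbit G ξ) :
    h = h' := by
  obtain ⟨g, rfl⟩ := ho
  funext x
  -- The power `x ^ (m * l)` lies in the subgroup of `h'`, and its conjugate by `g` in that of `h`.
  -- There the limits are `-h'` and `-h`, and `h` is conjugation invariant.
  obtain ⟨m, hm, -, hmem⟩ :=
    Subgroup.exists_pow_mem_of_index_ne_zero hh'.finiteIndex.index_ne_zero x
  obtain ⟨l, hl, -, hlem⟩ :=
    Subgroup.exists_pow_mem_of_index_ne_zero hh.finiteIndex.index_ne_zero (g⁻¹ * x * g)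
  have h1 : x ^ (m * l) ∈ Subgroup.closure (tightGenerators S h') := by
    rw [pow_mul]; exact pow_mem hmem l
  have h2 : g⁻¹ * x ^ (m * l) * g ∈ Subgroup.closure (tightGenerators S h) := by
    have h3 : (g⁻¹ * x * g) ^ l = g⁻¹ * x ^ l * g := by
      simpa using conj_pow (i := l) (a := g⁻¹) (b := x)
    have h4 : (g⁻¹ * x ^ l * g) ^ m = g⁻¹ * (x ^ l) ^ m * g := by
      simpa using conj_pow (i := m) (a := g⁻¹) (b := x ^ l)
    rw [mul_comm m, pow_mul, ← h4, ← h3]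
    exact pow_mem hlem m
  have h3 := hγ'.limit_apply hgen hsymm hh' hξ' h1
  rw [smul_apply, show g⁻¹ * x ^ (m * l) = g⁻¹ * x ^ (m * l) * g * g⁻¹ by group,
    apply_mul_of_smul_eq (hγ.smul_limit hgen hsymm hh hξ h2), mul_one,
    hγ.limit_apply hgen hsymm hh hξ h2, hh.additive.map_conj, hh.additive.map_pow,
    hh'.additive.map_pow] at h3
  have h5 : ((m * l : ℕ) : ℝ) ≠ 0 := by positivity
  exact mul_left_cancel₀ h5 (by linarith)

/-- A geodesic path converging to a point with finite orbit is eventually a facet ray. -/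
theorem IsGeodesicPath.exists_isFacetHom [Group.IsNilpotent G] (hgen : Subgroup.closure S = ⊤)
    (hsymm : ∀ s ∈ S, s⁻¹ ∈ S) {γ : ℕ → G} (hγ : IsGeodesicPath S γ) {ξ : horoBoundary S}
    (hξ : ConvergesTo S γ ξ) (ho : (MulAction.orbit G ξ).Finite) :
    ∃ h, IsFacetHom S h ∧
      ∀ᶠ n₀ in atTop, IsFacetRay S h fun n => (γ n₀)⁻¹ * γ (n₀ + n) := by
  obtain ⟨b, hb⟩ := hγ.exists_isBusemannFunction hgen
  have hξb := hb.apply_eq hξ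
  have hst : (MulAction.stabilizer G ξ).FiniteIndex := by
    refine ⟨?_⟩
    rw [MulAction.index_stabilizer]
    exact (Set.ncard_pos ho).2 (MulAction.nonempty_orbit ξ) |>.ne'
  set K := (MulAction.stabilizer G ξ).normalCore with hK
  have hKξ : ∀ k ∈ K, ∀ x, ξ.1 (k * x) = ξ.1 k + ξ.1 x := fun k hk x =>
    apply_mul_of_smul_eq (MulAction.mem_stabilizer_iff.1 (Subgroup.normalCore_le _ hk)) x
  -- The limit is additive on its stabiliser. The normal core still has finite index and allows the
  -- extension to `G`.
  obtain ⟨h, hh, hhK⟩ := exists_isAdditive_extension K (fun g => -ξ.1 g)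
    fun x hx y _ => by rw [hKξ x hx]; ring
  have hle : ∀ s ∈ S, h s ≤ 1 := by
    intro s hs
    obtain ⟨m, hm, -, hmem⟩ := Subgroup.exists_pow_mem_of_index_ne_zero (H := K)
      Subgroup.FiniteIndex.index_ne_zero s
    have h1 := hhK _ hmem
    rw [hh.map_pow, hξb] at h1
    have h2 := (abs_le.1 (hb.abs_sub_le hgen (s ^ m) 1)).1
    have h3 : (wordDist S 1 (1 * s ^ m) : ℝ) ≤ m := mod_cast wordDist_mul_pow_le hgen hs 1 m
    rw [one_mul, wordDist_comm] at h3
    have h4 : (0 : ℝ) < m := by exact_mod_cast hm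
    nlinarith
  -- The function `ξ + h` is constant on cosets of `K`, and `ξ (γ n) = -n - b 1`. Being also
  -- monotone, this sequence is eventually constant, so eventually all steps are tight.
  have hrange : (Set.range fun n : ℕ => (n : ℝ) - h (γ n)).Finite := by
    refine (Set.finite_range fun q : G ⧸ K => -(ξ.1 q.out + h q.out) - b 1).subset ?_
    rintro _ ⟨n, rfl⟩
    refine ⟨(γ n : G ⧸ K), ?_⟩
    have h1 : γ n * ((γ n : G ⧸ K).out)⁻¹ ∈ K := by
      have h2 : ((γ n : G ⧸ K).out)⁻¹ * γ n ∈ K := by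
        rw [← QuotientGroup.eq, QuotientGroup.out_eq']
      have := (inferInstance : K.Normal).conj_mem _ h2 (γ n : G ⧸ K).out
      simpa [mul_assoc] using this
    have h2 := hKξ _ h1 (γ n : G ⧸ K).out
    have h3 := hhK _ h1
    rw [inv_mul_cancel_right, hξb, hb.apply_path hγ] at h2
    rw [hh, hh.map_inv] at h3
    linarith
  have hmono : ∀ n, h ((γ n)⁻¹ * γ (n + 1)) ≤ 1 := fun n => hle _ (hγ.step_mem hsymm n)
  have hstep : ∀ᶠ n in atTop, h ((γ n)⁻¹ * γ (n + 1)) = 1 := by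
    have hm : Monotone fun n : ℕ => (n : ℝ) - h (γ n) := by
      refine monotone_nat_of_le_succ fun n => ?_
      have := hmono n
      rw [hh, hh.map_inv] at this
      push_cast
      linarith
    obtain ⟨_, ⟨m, rfl⟩, hmax⟩ := Set.exists_max_image _ id hrange ⟨_, 0, rfl⟩
    filter_upwards [eventually_ge_atTop m] with n hn
    have h1 := hmax _ ⟨n + 1, rfl⟩
    have h2 := hm hn
    have h3 := hmono n
    simp only [id] at h1 h2
    rw [hh, hh.map_inv] at h3 ⊢
    push_cast at h1
    linarith
  have hstep' : ∀ᶠ n₀ in atTop, ∀ n, (γ (n₀ + n))⁻¹ * γ (n₀ + n + 1) ∈ tightGenerators S h := by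
    obtain ⟨m, hm⟩ := eventually_atTop.1 hstep
    filter_upwards [eventually_ge_atTop m] with n₀ hn₀ n
    exact ⟨hγ.step_mem hsymm _, hm _ (by omega)⟩
  -- Since `ξ = -h` on `K`, the distance from `γ n₀ * k` to a late point of `γ` equals the increment
  -- of `h`, so a shortest path between them has only tight steps.
  have habs : ∀ n₀, (∀ n, (γ (n₀ + n))⁻¹ * γ (n₀ + n + 1) ∈ tightGenerators S h) → ∀ k ∈ K,
      ∃ n, k⁻¹ * ((γ n₀)⁻¹ * γ (n₀ + n)) ∈ Submonoid.closure (tightGenerators S h) := by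
    intro n₀ hn₀ k hk
    obtain ⟨n', hn', hle'⟩ := ((hb (γ n₀ * k)).and (eventually_ge_atTop n₀)).exists
    obtain ⟨n, rfl⟩ := Nat.exists_eq_add_of_le hle'
    refine ⟨n, (sub_le_wordDist_and_mem hgen hsymm hh hle _ _).2 ?_⟩
    have h1 : γ n₀ * k * (γ n₀)⁻¹ ∈ K := (inferInstance : K.Normal).conj_mem k hk _
    have h2 := hKξ _ h1 (γ n₀)
    have h3 := hhK _ h1
    rw [inv_mul_cancel_right, hξb _, hξb (γ n₀), hb.apply_path hγ] at h2
    rw [hh, hh, hh.map_inv] at h3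
    have h4 : wordDist S k ((γ n₀)⁻¹ * γ (n₀ + n)) = wordDist S (γ n₀ * k) (γ (n₀ + n)) := by
      rw [← wordDist_mul_left S (γ n₀) k, mul_inv_cancel_left]
    have h5 := map_path_of_step hh (γ := fun n => γ (n₀ + n)) (fun n => (hn₀ n).2) n
    rw [h4, hn', hh, hh.map_inv]
    push_cast
    simp only [add_zero] at h5
    linarith
  obtain ⟨n₁, hn₁⟩ := hstep'.exists
  have hmem : ∀ n₀, (∀ n, (γ (n₀ + n))⁻¹ * γ (n₀ + n + 1) ∈ tightGenerators S h) → ∀ n,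
      (γ n₀)⁻¹ * γ (n₀ + n) ∈ Subgroup.closure (tightGenerators S h) := fun n₀ hn₀ n =>
    mem_subgroup_closure_of_mem_closure
      (by simpa using inv_mul_mem_closure_of_step (γ := fun n => γ (n₀ + n)) hn₀ 0 n)
  have hKH : K ≤ Subgroup.closure (tightGenerators S h) := by
    intro k hk
    obtain ⟨n, hn⟩ := habs n₁ hn₁ k hk
    have := mul_mem (hmem n₁ hn₁ n) (inv_mem (mem_subgroup_closure_of_mem_closure hn))
    simpa [mul_assoc] using this
  refine ⟨h, ⟨hh, hle, Subgroup.finiteIndex_of_le hKH, ⟨_, hn₁ 0⟩⟩, ?_⟩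
  filter_upwards [hstep'] with n₀ hn₀
  refine ⟨hmem n₀ hn₀, fun n => ?_, fun v hv => ?_⟩
  · have := hn₀ n
    simpa [mul_assoc, add_assoc] using this
  -- Only elements of `K` are absorbed so far. The decomposition `v⁻¹ = c * (v * c) ^ l * ((v * c) ^
  -- (l + 1))⁻¹` reduces `v` to a power in `K`, up to elements of the monoid.
  · obtain ⟨c, hc, hvc⟩ := exists_mul_eq_of_mem_closure hv
    obtain ⟨m, hm, -, hmem'⟩ := Subgroup.exists_pow_mem_of_index_ne_zero (H := K)
      Subgroup.FiniteIndex.index_ne_zero (v * c)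
    obtain ⟨n, hn⟩ := habs n₀ hn₀ _ hmem'
    obtain ⟨l, rfl⟩ := Nat.exists_eq_succ_of_ne_zero hm.ne'
    refine ⟨n, ?_⟩
    convert mul_mem (mul_mem hc (pow_mem hvc l)) hn using 1
    rw [Nat.succ_eq_add_one, pow_succ']
    group

/-! ### Periodic paths of facet words -/

section PeriodicPath

theorem periodicPath_zero (w : List G) : periodicPath w 0 = 1 := by
  simp [periodicPath]

theorem periodicPath_mul (w : List G) (hw : w ≠ []) (q : ℕ) :
    periodicPath w (w.length * q) = w.prod ^ q := by
  have := List.length_pos_of_ne_nil hw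
  simp [periodicPath, this]

theorem periodicPath_step_mem {w : List G} (hw : w ≠ []) (n : ℕ) :
    (periodicPath w n)⁻¹ * periodicPath w (n + 1) ∈ w := by
  have hpos := List.length_pos_of_ne_nil hw
  have hlt := Nat.mod_lt n hpos
  have htake : (w.take (n % w.length + 1)).prod =
      (w.take (n % w.length)).prod * w[n % w.length] := by
    rw [List.prod_take_succ]
  suffices periodicPath w (n + 1) = periodicPath w n * w[n % w.length] by
    rw [this, inv_mul_cancel_left]
    exact List.getElem_mem hlt
  rcases Nat.lt_or_ge (n % w.length + 1) w.length with hl | hl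
  · have h1 : (n + 1) % w.length = n % w.length + 1 := by
      rw [Nat.add_mod, Nat.mod_eq_of_lt (show 1 < w.length by omega), Nat.mod_eq_of_lt hl]
    have h2 : (n + 1) / w.length = n / w.length := by
      rw [Nat.add_div hpos, Nat.mod_eq_of_lt (show 1 < w.length by omega), if_neg (by omega),
        Nat.div_eq_of_lt (show 1 < w.length by omega)]
      simp
    rw [periodicPath, h1, h2, htake, periodicPath, mul_assoc]
  · have h0 : n % w.length + 1 = w.length := by omega
    have h1 : n + 1 = w.length * (n / w.length + 1) := by
      have := Nat.div_add_mod n w.length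
      rw [mul_add]; omega
    rw [h1, periodicPath_mul w hw, periodicPath, mul_assoc, ← htake, h0, List.take_length, pow_succ]

theorem IsFacetWord.isFacetRay [Group.IsNilpotent G] {h : G → ℝ} (hh : IsFacetHom S h)
    {w : List G} (hw : IsFacetWord (tightGenerators S h) w) :
    IsFacetRay S h (periodicPath w) := by
  have hne : w ≠ [] := by
    rintro rfl
    obtain ⟨s, hs⟩ := hh.nonempty
    obtain ⟨x, y, hx, hy, hxy⟩ := hw.2 s (.base hs)
    rw [List.infix_nil] at hx hy
    subst hx hy
    have h1 : s = 1 := by simpa using hxy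
    have h2 := hs.2
    rw [h1, hh.additive.map_one] at h2
    exact zero_ne_one h2
  have hstep : ∀ n, (periodicPath w n)⁻¹ * periodicPath w (n + 1) ∈ tightGenerators S h :=
    fun n => hw.1 _ (periodicPath_step_mem hne n)
  refine ⟨fun n => ?_, hstep, fun v hv => ?_⟩
  · have := inv_mul_mem_closure_of_step hstep 0 n
    rw [periodicPath_zero, inv_one, one_mul, zero_add] at this
    exact mem_subgroup_closure_of_mem_closure this
  · obtain ⟨n, hn⟩ := hw.exists_mul_pow_mem (inv_mem hv)
    exact ⟨w.length * n, by rwa [periodicPath_mul w hne]⟩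

end PeriodicPath

end NilpotentHoro

/-! ### The projection to `ℝ ^ N` and the facets of the polytope -/

namespace NilpotentHoro

variable {G : Type*} [Group G] {S : Set G} {N : ℕ}
  (e : Additive (Abelianization G ⧸ CommGroup.torsion (Abelianization G)) ≃+ (Fin N → ℤ))

section Projection

theorem proj_mul (a b : G) : proj e (a * b) = proj e a + proj e b := by
  funext i
  simp [proj]

theorem isAdditive_comp_proj (f : (Fin N → ℝ) →ₗ[ℝ] ℝ) : IsAdditive fun g => f (proj e g) :=
  fun a b => by simp only [proj_mul, map_add]

theorem proj_one : proj e (1 : G) = 0 := by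
  simpa using proj_mul e 1 1

theorem proj_inv (a : G) : proj e a⁻¹ = -proj e a := by
  have := proj_mul e a⁻¹ a
  rw [inv_mul_cancel, proj_one] at this
  exact (neg_eq_of_add_eq_zero_left this.symm).symm

theorem proj_pow (a : G) (n : ℕ) : proj e (a ^ n) = (n : ℝ) • proj e a := by
  induction n with
  | zero => simp [proj_one]
  | succ n ih => rw [pow_succ, proj_mul, ih]; push_cast; rw [add_smul, one_smul]

theorem exists_proj_eq (v : Fin N → ℤ) : ∃ g : G, proj e g = fun i => (v i : ℝ) := by
  obtain ⟨q, hq⟩ := QuotientGroup.mk_surjective (e.symm v).toMul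
  obtain ⟨g, hg⟩ := QuotientGroup.mk_surjective q
  refine ⟨g, funext fun i => ?_⟩
  have h1 : (Abelianization.of g : Abelianization G) = q := hg
  rw [proj, h1, hq]
  simp

theorem span_range_proj : Submodule.span ℝ (Set.range (proj e : G → Fin N → ℝ)) = ⊤ := by
  rw [eq_top_iff, ← (Pi.basisFun ℝ (Fin N)).span_eq, Submodule.span_le]
  rintro _ ⟨i, rfl⟩
  obtain ⟨g, hg⟩ := exists_proj_eq e (Pi.single i 1)
  refine Submodule.subset_span ⟨g, ?_⟩
  rw [hg]
  funext j
  rcases eq_or_ne j i with rfl | hj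
  · simp
  · simp [hj]

theorem linearMap_eq_of_comp_proj_eq {f f' : (Fin N → ℝ) →ₗ[ℝ] ℝ}
    (h : ∀ g : G, f (proj e g) = f' (proj e g)) : f = f' :=
  LinearMap.ext_on (span_range_proj e) (by rintro _ ⟨g, rfl⟩; exact h g)

/-- Every homomorphism to `ℝ` factors through the projection. -/
theorem IsAdditive.exists_linearMap {h : G → ℝ} (hh : IsAdditive h) :
    ∃ f : (Fin N → ℝ) →ₗ[ℝ] ℝ, ∀ g, h g = f (proj e g) := by
  let h₀ : G →* Multiplicative ℝ :=
    { toFun := fun g => Multiplicative.ofAdd (h g)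
      map_one' := by rw [hh.map_one]; rfl
      map_mul' := fun a b => by rw [hh]; rfl }
  let h₁ : Abelianization G ⧸ CommGroup.torsion (Abelianization G) →* Multiplicative ℝ :=
    QuotientGroup.lift _ (Abelianization.lift h₀) (by
      intro x hx
      -- The additive group of `ℝ` has no torsion, so the homomorphism factors through the quotient
      -- by torsion.
      obtain ⟨n, hn, hxn⟩ := isOfFinOrder_iff_pow_eq_one.1 ((CommGroup.mem_torsion _).1 hx)
      have h2 : (Abelianization.lift h₀ x) ^ n = 1 := by rw [← _root_.map_pow, hxn, _root_.map_one]
      have h3 : n • (Abelianization.lift h₀ x).toAdd = 0 := by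
        rw [← toAdd_pow, h2]; rfl
      exact (smul_eq_zero.1 h3).resolve_left hn.ne')
  let k : (Fin N → ℤ) →+ ℝ := (MonoidHom.toAdditiveLeft h₁).comp e.symm.toAddMonoidHom
  have hk : ∀ g : G, h g = k (e (Additive.ofMul (QuotientGroup.mk (Abelianization.of g)))) := by
    intro g
    simp [k, h₁, h₀]
  refine ⟨∑ i, (k (Pi.single i 1)) • LinearMap.proj i, fun g => ?_⟩
  rw [hk]
  set v := e (Additive.ofMul (QuotientGroup.mk (Abelianization.of g))) with hv
  have hsum : v = ∑ i, v i • Pi.single i (1 : ℤ) := by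
    simpa using (pi_eq_sum_univ' v)
  conv_lhs => rw [hsum]
  simp only [map_sum, map_zsmul]
  simp [proj, ← hv, mul_comm]

theorem proj_mem_span_of_mem_closure {V : Set G} {g : G} (hg : g ∈ Subgroup.closure V) :
    proj e g ∈ Submodule.span ℝ (proj e '' V) := by
  induction hg using Subgroup.closure_induction with
  | mem x hx => exact Submodule.subset_span (Set.mem_image_of_mem _ hx)
  | one => rw [proj_one]; exact zero_mem _
  | mul x y _ _ hx hy => rw [proj_mul]; exact add_mem hx hy
  | inv x _ hx => rw [proj_inv]; exact neg_mem hx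

theorem span_proj_image_eq_top {V : Set G} (hV : (Subgroup.closure V).FiniteIndex) :
    Submodule.span ℝ (proj e '' V) = ⊤ := by
  rw [eq_top_iff, ← span_range_proj e, Submodule.span_le]
  rintro _ ⟨g, rfl⟩
  obtain ⟨m, hm, -, hmem⟩ := Subgroup.exists_pow_mem_of_index_ne_zero hV.index_ne_zero g
  have h1 := proj_mem_span_of_mem_closure e hmem
  rw [proj_pow] at h1
  have hm' : (m : ℝ) ≠ 0 := by positivity
  exact (Submodule.smul_mem_iff _ hm').1 h1

theorem finiteIndex_of_span_proj_image_eq_top [Group.IsNilpotent G] [Group.FG G] {V : Set G}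
    (hV : Submodule.span ℝ (proj e '' V) = ⊤) : (Subgroup.closure V).FiniteIndex := by
  refine finiteIndex_of_forall_isAdditive G inferInstance _ fun h hh hv g => ?_
  obtain ⟨f, hf⟩ := hh.exists_linearMap e
  have : f = 0 := by
    refine LinearMap.ext_on hV ?_
    rintro _ ⟨s, hs, rfl⟩
    rw [← hf, hv s (Subgroup.subset_closure hs)]
    rfl
  rw [hf, this]
  rfl

end Projection

section Facets

/-- By symmetry `2 φ(s) = φ(s) - φ(s⁻¹)` is a difference of points of the polytope. -/
theorem vectorSpan_polytope (hgen : Subgroup.closure S = ⊤) (hsymm : ∀ s ∈ S, s⁻¹ ∈ S) :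
    vectorSpan ℝ (polytope S e) = ⊤ := by
  have h1 : Submodule.span ℝ (proj e '' S) = ⊤ :=
    span_proj_image_eq_top e (by rw [hgen]; infer_instance)
  rw [eq_top_iff, ← h1, Submodule.span_le]
  rintro _ ⟨s, hs, rfl⟩
  have hmem : ∀ s ∈ S, proj e s ∈ polytope S e := fun s hs =>
    subset_convexHull ℝ _ (Set.mem_image_of_mem _ hs)
  have h2 := vsub_mem_vectorSpan ℝ (hmem s hs) (hmem _ (hsymm s hs))
  rw [proj_inv, vsub_eq_sub, sub_neg_eq_add, ← two_smul ℝ] at h2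
  exact (Submodule.smul_mem_iff _ two_ne_zero).1 h2

theorem finrank_vectorSpan_polytope (hgen : Subgroup.closure S = ⊤)
    (hsymm : ∀ s ∈ S, s⁻¹ ∈ S) : Module.finrank ℝ (vectorSpan ℝ (polytope S e)) = N := by
  rw [vectorSpan_polytope e hgen hsymm, finrank_top]
  simp

/-- The part of the polytope where the linear functional `f` takes the value `1`. -/
def cutFace (S : Set G) (f : (Fin N → ℝ) →ₗ[ℝ] ℝ) : Set (Fin N → ℝ) :=
  {x ∈ polytope S e | f x = 1}

variable {f : (Fin N → ℝ) →ₗ[ℝ] ℝ}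

theorem generatorsOver_cutFace :
    generatorsOver S e (cutFace e S f) = tightGenerators S fun g => f (proj e g) := by
  ext s
  constructor
  · rintro ⟨hs, -, h⟩
    exact ⟨hs, h⟩
  · rintro ⟨hs, h⟩
    exact ⟨hs, subset_convexHull ℝ _ (Set.mem_image_of_mem _ hs), h⟩

theorem le_one_of_mem_polytope (hle : ∀ s ∈ S, f (proj e s) ≤ 1) {x : Fin N → ℝ}
    (hx : x ∈ polytope S e) : f x ≤ 1 := by
  refine convexHull_min ?_ (convex_halfSpace_le f.isLinear 1) hx
  rintro _ ⟨s, hs, rfl⟩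
  exact hle s hs

theorem cutFace_subset_span (hle : ∀ s ∈ S, f (proj e s) ≤ 1) :
    cutFace e S f ⊆
      Submodule.span ℝ (proj e '' tightGenerators S fun g => f (proj e g)) := by
  set W := Submodule.span ℝ (proj e '' tightGenerators S fun g => f (proj e g)) with hW
  -- A convex combination reaches the maximum `1` only if every point of non-zero weight does. This
  -- set contains `φ(S)`, hence the polytope.
  have hconv : Convex ℝ {x | f x ≤ 1 ∧ (f x = 1 → x ∈ W)} := by
    rintro x ⟨hx, hxW⟩ y ⟨hy, hyW⟩ a b ha hb hab
    simp only [Set.mem_ofPred_eq, map_add, map_smul, smul_eq_mul]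
    refine ⟨by nlinarith, fun h => ?_⟩
    have h1 : a * (1 - f x) = 0 := by
      nlinarith [mul_nonneg ha (sub_nonneg.2 hx), mul_nonneg hb (sub_nonneg.2 hy)]
    have h2 : b * (1 - f y) = 0 := by
      nlinarith [mul_nonneg ha (sub_nonneg.2 hx), mul_nonneg hb (sub_nonneg.2 hy)]
    refine add_mem ?_ ?_
    · rcases mul_eq_zero.1 h1 with h | h
      · rw [h, zero_smul]; exact zero_mem _
      · exact W.smul_mem _ (hxW (by linarith))
    · rcases mul_eq_zero.1 h2 with h | h
      · rw [h, zero_smul]; exact zero_mem _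
      · exact W.smul_mem _ (hyW (by linarith))
  rintro x ⟨hx, hfx⟩
  refine (convexHull_min ?_ hconv hx).2 hfx
  rintro _ ⟨s, hs, rfl⟩
  exact ⟨hle s hs, fun h => Submodule.subset_span (Set.mem_image_of_mem _ ⟨hs, h⟩)⟩

theorem vectorSpan_cutFace_le_ker : vectorSpan ℝ (cutFace e S f) ≤ LinearMap.ker f := by
  rw [vectorSpan, Submodule.span_le]
  rintro _ ⟨x, hx, y, hy, rfl⟩
  simp [hx.2, hy.2]

theorem cutFace_mem_facets (hgen : Subgroup.closure S = ⊤) (hsymm : ∀ s ∈ S, s⁻¹ ∈ S)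
    (hf : IsFacetHom S fun g => f (proj e g)) : cutFace e S f ∈ facets (polytope S e) := by
  have hle : ∀ x ∈ polytope S e, f x ≤ 1 := fun x hx => le_one_of_mem_polytope e hf.le_one hx
  obtain ⟨s, hs⟩ := hf.nonempty
  have hsF : proj e s ∈ cutFace e S f :=
    ⟨subset_convexHull ℝ _ (Set.mem_image_of_mem _ hs.1), hs.2⟩
  refine ⟨fun _ => ⟨LinearMap.toContinuousLinearMap f, ?_⟩, ⟨_, hsF⟩, ?_⟩
  · ext x
    simp only [cutFace, Set.mem_ofPred_eq, LinearMap.coe_toContinuousLinearMap']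
    refine and_congr_right fun hx => ⟨fun h y hy => by rw [h]; exact hle y hy, fun h => ?_⟩
    exact le_antisymm (hle x hx) (hsF.2 ▸ h _ hsF.1)
  · rw [finrank_vectorSpan_polytope e hgen hsymm]
    have h1 : vectorSpan ℝ (cutFace e S f) < ⊤ := by
      refine lt_of_le_of_lt (vectorSpan_cutFace_le_ker e) (lt_top_iff_ne_top.2 fun h => ?_)
      have h2 : f (proj e s) = 0 := LinearMap.mem_ker.1 (h ▸ Submodule.mem_top)
      exact one_ne_zero (hsF.2.symm.trans h2)
    have h2 := Submodule.finrank_lt h1.ne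
    -- The directions of the face together with one of its points span `ℝ ^ N`, so they have
    -- dimension at least `N - 1`. They lie in the kernel of `f ≠ 0`, so the dimension is at most
    -- that.
    have h3 : (⊤ : Submodule ℝ (Fin N → ℝ)) ≤
        vectorSpan ℝ (cutFace e S f) ⊔ Submodule.span ℝ {proj e s} := by
      rw [← span_proj_image_eq_top e hf.finiteIndex, Submodule.span_le]
      rintro _ ⟨t, ht, rfl⟩
      have h4 : proj e t ∈ cutFace e S f :=
        ⟨subset_convexHull ℝ _ (Set.mem_image_of_mem _ ht.1), ht.2⟩
      have h5 := add_mem (Submodule.mem_sup_left (vsub_mem_vectorSpan ℝ h4 hsF))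
        (Submodule.mem_sup_right (S := vectorSpan ℝ (cutFace e S f))
          (Submodule.mem_span_singleton_self (R := ℝ) (proj e s)))
      simpa using h5
    have h4 := Submodule.finrank_mono h3
    have h5 := Submodule.finrank_add_le_finrank_add_finrank (vectorSpan ℝ (cutFace e S f))
      (Submodule.span ℝ {proj e s})
    have h6 := finrank_span_singleton (K := ℝ) (v := proj e s) fun h0 => by
      have h7 : f (proj e s) = 1 := hs.2
      rw [h0, map_zero] at h7
      exact zero_ne_one h7
    simp only [finrank_top, Module.finrank_fin_fun] at h2 h4
    omega

theorem exists_cutFace_eq [Group.IsNilpotent G] [Group.FG G] (hgen : Subgroup.closure S = ⊤)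
    (hsymm : ∀ s ∈ S, s⁻¹ ∈ S) {F : Set (Fin N → ℝ)} (hF : F ∈ facets (polytope S e)) :
    ∃ f : (Fin N → ℝ) →ₗ[ℝ] ℝ, (IsFacetHom S fun g => f (proj e g)) ∧ F = cutFace e S f := by
  obtain ⟨hexp, ⟨x₀, hx₀⟩, hdim⟩ := hF
  obtain ⟨l, hl⟩ := hexp ⟨x₀, hx₀⟩
  have hmem : ∀ s ∈ S, proj e s ∈ polytope S e := fun s hs =>
    subset_convexHull ℝ _ (Set.mem_image_of_mem _ hs)
  have hx₀' := hx₀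
  rw [hl] at hx₀'
  -- Otherwise `l ≤ 0` on the symmetric set `φ(S)`, so `l = 0` and the face is the whole polytope,
  -- of the wrong dimension. Positivity lets the maximum be scaled to `1`.
  have hpos : 0 < l x₀ := by
    by_contra! hcon
    have hl0 : (l : (Fin N → ℝ) →ₗ[ℝ] ℝ) = 0 := by
      refine LinearMap.ext_on (span_proj_image_eq_top e (V := S)
        (by rw [hgen]; infer_instance)) ?_
      rintro _ ⟨s, hs, rfl⟩
      have h1 := (hx₀'.2 _ (hmem s hs)).trans hcon
      have h2 := (hx₀'.2 _ (hmem _ (hsymm s hs))).trans hcon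
      rw [proj_inv, map_neg] at h2
      exact le_antisymm h1 (neg_nonpos.1 h2)
    have h3 : ∀ x, l x = 0 := fun x => LinearMap.congr_fun hl0 x
    have h4 : F = polytope S e := by rw [hl]; ext x; simp [h3]
    rw [h4] at hdim
    omega
  let f : (Fin N → ℝ) →ₗ[ℝ] ℝ := (l x₀)⁻¹ • (l : (Fin N → ℝ) →ₗ[ℝ] ℝ)
  have hf : ∀ x, f x = l x / l x₀ := fun x => by simp [f, div_eq_inv_mul]
  have hFf : F = cutFace e S f := by
    rw [hl]
    ext x
    simp only [cutFace, Set.mem_ofPred_eq, hf, div_eq_one_iff_eq hpos.ne']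
    exact and_congr_right fun hx => ⟨fun h => le_antisymm (hx₀'.2 x hx) (h _ hx₀'.1),
      fun h y hy => h ▸ hx₀'.2 y hy⟩
  have hle : ∀ s ∈ S, f (proj e s) ≤ 1 := fun s hs => by
    rw [hf, div_le_one hpos]
    exact hx₀'.2 _ (hmem s hs)
  have hspan := cutFace_subset_span e hle
  rw [← hFf] at hspan
  set V := tightGenerators S fun g => f (proj e g) with hV
  have hfx₀ : f x₀ = 1 := by rw [hf, div_self hpos.ne']
  have htop : Submodule.span ℝ (proj e '' V) = ⊤ := by
    -- The span contains `x₀` with `f x₀ = 1`, but `f` vanishes on the directions of `F`, which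
    -- already have dimension `N - 1`.
    have h1 : vectorSpan ℝ F < Submodule.span ℝ (proj e '' V) := by
      refine lt_of_le_of_ne ?_ fun h => ?_
      · rw [vectorSpan, Submodule.span_le]
        rintro _ ⟨x, hx, y, hy, rfl⟩
        exact sub_mem (hspan hx) (hspan hy)
      · have h2 : x₀ ∈ vectorSpan ℝ F := h ▸ hspan hx₀
        rw [hFf] at h2
        have h3 : f x₀ = 0 := LinearMap.mem_ker.1 (vectorSpan_cutFace_le_ker e h2)
        exact one_ne_zero (hfx₀.symm.trans h3)
    have h2 := Submodule.finrank_lt_finrank_of_lt h1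
    rw [finrank_vectorSpan_polytope e hgen hsymm] at hdim
    refine Submodule.eq_top_of_finrank_eq (le_antisymm (Submodule.finrank_le _) ?_)
    rw [Module.finrank_fin_fun]
    omega
  refine ⟨f, ⟨isAdditive_comp_proj e f, hle, finiteIndex_of_span_proj_image_eq_top e htop, ?_⟩, hFf⟩
  by_contra hempty
  have hV0 : V = ∅ := Set.not_nonempty_iff_eq_empty.1 hempty
  rw [hV0, Set.image_empty, Submodule.span_empty] at htop
  have h1 : x₀ ∈ (⊥ : Submodule ℝ (Fin N → ℝ)) := htop ▸ Submodule.mem_top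
  rw [Submodule.mem_bot] at h1
  rw [h1, map_zero] at hpos
  exact lt_irrefl _ hpos

end Facets

end NilpotentHoro

/-! ### The bijection between facets and finite orbits -/

namespace NilpotentHoro

section Bijection

variable {G : Type*} [Group G] {S : Set G} {N : ℕ}
  (e : Additive (Abelianization G ⧸ CommGroup.torsion (Abelianization G)) ≃+ (Fin N → ℤ))

theorem exists_facetRay_of_mem_facets [Group.IsNilpotent G] (hfin : S.Finite)
    (hgen : Subgroup.closure S = ⊤) (hsymm : ∀ s ∈ S, s⁻¹ ∈ S) {F : Set (Fin N → ℝ)}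
    (hF : F ∈ facets (polytope S e)) :
    ∃ (f : (Fin N → ℝ) →ₗ[ℝ] ℝ) (γ : ℕ → G) (ξ : horoBoundary S),
      (IsFacetHom S fun g => f (proj e g)) ∧ F = cutFace e S f ∧
      (IsFacetRay S (fun g => f (proj e g)) γ) ∧ ConvergesTo S γ ξ := by
  have : Group.FG G := Group.fg_iff.2 ⟨S, hgen, hfin⟩
  obtain ⟨f, hf, rfl⟩ := exists_cutFace_eq e hgen hsymm hF
  obtain ⟨w, hw⟩ := exists_isFacetWord
    (hfin.subset fun s (hs : s ∈ tightGenerators S fun g => f (proj e g)) => hs.1)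
  have hray := hw.isFacetRay hf
  obtain ⟨ξ, hξ⟩ := (hray.isGeodesicPath hgen hsymm hf).exists_convergesTo hgen
  exact ⟨f, _, ξ, hf, rfl, hray, hξ⟩

/-- If the directions of a path that is eventually a facet ray of `h₀` also lie over the facet cut
out by `f`, then `h₀` is the homomorphism given by `f`. -/
theorem eq_of_direction_subset (hfin : S.Finite) (hgen : Subgroup.closure S = ⊤)
    (hsymm : ∀ s ∈ S, s⁻¹ ∈ S) {h h₀ : G → ℝ} (hh : IsAdditive h) (hle : ∀ s ∈ S, h s ≤ 1)
    (hh₀ : IsFacetHom S h₀) {γ : ℕ → G} (hγ : IsGeodesicPath S γ)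
    (hray : ∀ᶠ n₀ in atTop, IsFacetRay S h₀ fun n => (γ n₀)⁻¹ * γ (n₀ + n))
    (hdir : ∀ s ∈ direction γ, h s = 1) : h = h₀ := by
  -- As `S` is finite, eventually only elements of the direction occur as steps.
  have hev : ∀ᶠ n in atTop, h ((γ n)⁻¹ * γ (n + 1)) = 1 := by
    have h1 : ∀ s ∈ S, ∀ᶠ n in atTop, (γ n)⁻¹ * γ (n + 1) = s → h s = 1 := by
      intro s _
      by_cases hs : s ∈ direction γ
      · exact Eventually.of_forall fun _ _ => hdir s hs
      · filter_upwards [not_frequently.1 hs] with n hn he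
        exact absurd he hn
    filter_upwards [(hfin.eventually_all).2 h1] with n hn
    exact hn _ (hγ.step_mem hsymm n) rfl
  obtain ⟨m, hm⟩ := eventually_atTop.1 hev
  obtain ⟨n₀, hn₀, hmn₀⟩ := (hray.and (eventually_ge_atTop m)).exists
  -- Along the tail `h` and `h₀` agree. From `v` to a late point, the increment of `h₀` is the
  -- distance, which bounds the increment of `h`. Applying this to `v⁻¹` as well gives equality.
  have hle' : ∀ v ∈ Subgroup.closure (tightGenerators S h₀), h₀ v ≤ h v := by
    intro v hv
    obtain ⟨n, hn⟩ := hn₀.absorb v hv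
    have h1 := wordDist_eq_sub hgen hsymm hh₀.additive hh₀.le_one hn
    have h2 := sub_le_wordDist hgen hsymm hh hle v ((γ n₀)⁻¹ * γ (n₀ + n))
    have h3 := hn₀.map_path hh₀.additive n
    have h4 := map_path_of_step hh (γ := fun n => (γ n₀)⁻¹ * γ (n₀ + n)) (fun k => by
      simpa [mul_assoc, add_assoc] using hm (n₀ + k) (by omega)) n
    simp only [add_zero, inv_mul_cancel, hh.map_one, hh₀.additive.map_one] at h3 h4
    linarith
  have := hh₀.finiteIndex
  refine hh.eq_of_eq_on hh₀.additive (Subgroup.closure (tightGenerators S h₀)) fun v hv => ?_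
  have h1 := hle' v hv
  have h2 := hle' _ (inv_mem hv)
  rw [hh.map_inv, hh₀.additive.map_inv] at h2
  linarith

end Bijection

end NilpotentHoro

open NilpotentHoro

theorem theorem1 {G : Type*} [Group G] [Group.IsNilpotent G]
    (S : Set G) (hfin : S.Finite) (hgen : Subgroup.closure S = ⊤) (hsymm : ∀ s ∈ S, s⁻¹ ∈ S)
    (N : ℕ)
    (e : Additive (Abelianization G ⧸ CommGroup.torsion (Abelianization G)) ≃+ (Fin N → ℤ)) :
    ∃ Φ : NilpotentHoro.facets (NilpotentHoro.polytope S e) ≃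
        NilpotentHoro.finiteBusemannOrbits S,
      (∀ F : NilpotentHoro.facets (NilpotentHoro.polytope S e),
        (∃ w : List G, NilpotentHoro.IsFacetWord (NilpotentHoro.generatorsOver S e F.1) w) ∧
        ∀ w : List G, NilpotentHoro.IsFacetWord (NilpotentHoro.generatorsOver S e F.1) w →
          NilpotentHoro.IsGeodesicPath S (NilpotentHoro.periodicPath w) ∧
          ∃ ξ : NilpotentHoro.horoBoundary S,
            NilpotentHoro.ConvergesTo S (NilpotentHoro.periodicPath w) ξ ∧
            (Φ F).1 = MulAction.orbit G ξ) ∧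
      (∀ (F : NilpotentHoro.facets (NilpotentHoro.polytope S e)) (γ : ℕ → G)
        (ξ : NilpotentHoro.horoBoundary S),
        NilpotentHoro.IsGeodesicPath S γ → NilpotentHoro.ConvergesTo S γ ξ →
        (MulAction.orbit G ξ).Finite →
          (ξ ∈ (Φ F).1 ↔ ∀ s ∈ NilpotentHoro.direction γ, NilpotentHoro.proj e s ∈ F.1)) := by
  have hex := fun F : facets (polytope S e) => exists_facetRay_of_mem_facets e hfin hgen hsymm F.2
  choose f ray pt hf hF hray hpt using hex
  have horb : ∀ F, (MulAction.orbit G (pt F)).Finite := fun F =>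
    (hray F).orbit_finite hgen hsymm (hf F) (hpt F)
  have hinj : ∀ F F', pt F' ∈ MulAction.orbit G (pt F) → F = F' := by
    intro F F' ho
    have h1 := (hf F).eq_of_limits_mem_orbit hgen hsymm (hf F') (hray F) (hray F') (hpt F)
      (hpt F') ho
    have h2 := linearMap_eq_of_comp_proj_eq e (congrFun h1)
    exact Subtype.ext (by rw [hF F, hF F', h2])
  have hloc : ∀ (γ : ℕ → G) (ξ : horoBoundary S), IsGeodesicPath S γ → ConvergesTo S γ ξ →
      (MulAction.orbit G ξ).Finite → ∃ F, ξ ∈ MulAction.orbit G (pt F) ∧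
        ∀ᶠ n₀ in Filter.atTop,
          IsFacetRay S (fun g => f F (proj e g)) fun n => (γ n₀)⁻¹ * γ (n₀ + n) := by
    intro γ ξ hγ hξ ho
    obtain ⟨h, hh, hev⟩ := hγ.exists_isFacetHom hgen hsymm hξ ho
    obtain ⟨l, hl⟩ := hh.additive.exists_linearMap e
    obtain rfl : h = fun g => l (proj e g) := funext hl
    set F : facets (polytope S e) := ⟨cutFace e S l, cutFace_mem_facets e hgen hsymm hh⟩
    have htight : (tightGenerators S fun g => f F (proj e g)) =
        tightGenerators S fun g => l (proj e g) := by
      rw [← generatorsOver_cutFace, ← generatorsOver_cutFace, ← hF F]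
    -- The functional chosen for `F` need not be `l` a priori. Both equal `1` on the same
    -- generators, which generate a subgroup of finite index.
    have heq : (fun g => f F (proj e g)) = fun g => l (proj e g) := by
      have := hh.finiteIndex
      refine (hf F).additive.eq_of_eq_on hh.additive
        (Subgroup.closure (tightGenerators S fun g => l (proj e g))) fun v hv => ?_
      induction hv using Subgroup.closure_induction with
      | mem s hs =>
        have h1 : s ∈ tightGenerators S fun g => f F (proj e g) := by rwa [htight]
        exact h1.2.trans hs.2.symm
      | one => simp [proj_one]
      | mul x y _ _ hx hy => simpa [proj_mul] using congrArg₂ (· + ·) hx hy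
      | inv x _ hx => simpa [proj_inv] using hx
    refine ⟨F, ?_, by rwa [heq]⟩
    obtain ⟨n₀, hn₀⟩ := hev.exists
    have h1 : (γ n₀)⁻¹ • ξ = pt F :=
      hn₀.limit_unique hgen hsymm hh (heq ▸ hray F) ((hξ.shift n₀).smul _) (hpt F)
    exact ⟨γ n₀, by rw [← h1]; exact smul_inv_smul _ _⟩
  let Φ₀ : facets (polytope S e) → finiteBusemannOrbits S := fun F =>
    ⟨MulAction.orbit G (pt F), horb F, pt F,
      ⟨ray F, (hray F).isGeodesicPath hgen hsymm (hf F), hpt F⟩, rfl⟩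
  have hΦ₀ : Function.Bijective Φ₀ := by
    refine ⟨fun F F' h => hinj F F' ?_, ?_⟩
    · have h1 : MulAction.orbit G (pt F) = MulAction.orbit G (pt F') := congrArg Subtype.val h
      rw [h1]
      exact MulAction.mem_orbit_self _
    · rintro ⟨_, hO, ξ, ⟨γ, hγ, hξ⟩, rfl⟩
      obtain ⟨F, hFξ, -⟩ := hloc γ ξ hγ hξ hO
      exact ⟨F, Subtype.ext (MulAction.orbit_eq_iff.2 hFξ).symm⟩
  have hgens : ∀ F, generatorsOver S e F.1 = tightGenerators S fun g => f F (proj e g) :=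
    fun F => by rw [← generatorsOver_cutFace, ← hF F]
  refine ⟨Equiv.ofBijective Φ₀ hΦ₀, fun F => ⟨?_, fun w hw => ?_⟩, fun F γ ξ hγ hξ ho => ?_⟩
  · exact exists_isFacetWord (hfin.subset fun s hs => hs.1)
  · rw [hgens] at hw
    have h1 := hw.isFacetRay (hf F)
    have h2 := h1.isGeodesicPath hgen hsymm (hf F)
    obtain ⟨ξ, hξ⟩ := h2.exists_convergesTo hgen
    refine ⟨h2, ξ, hξ, ?_⟩
    rw [h1.limit_unique hgen hsymm (hf F) (hray F) hξ (hpt F)]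
    rfl
  · obtain ⟨F', hF', hev⟩ := hloc γ ξ hγ hξ ho
    change ξ ∈ MulAction.orbit G (pt F) ↔ _
    constructor
    · intro hmem
      obtain rfl : F = F' := hinj F F' (by
        rw [← MulAction.orbit_eq_iff.2 hmem, MulAction.orbit_eq_iff.2 hF']
        exact MulAction.mem_orbit_self _)
      intro s hs
      obtain ⟨n₀, hn₀⟩ := Filter.eventually_atTop.1 hev
      obtain ⟨n, hn, rfl⟩ := (Filter.frequently_atTop.1 hs) n₀
      have h1 := (hn₀ n hn).step 0
      rw [← hgens] at h1
      simpa [mul_assoc] using h1.2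
    · intro hdir
      have h1 := eq_of_direction_subset hfin hgen hsymm (hf F).additive (hf F).le_one (hf F') hγ hev
        fun s hs => by
          have := hdir s hs
          rw [hF F] at this
          exact this.2
      have h2 := linearMap_eq_of_comp_proj_eq e (congrFun h1)
      obtain rfl : F = F' := Subtype.ext (by rw [hF F, hF F', h2])
      exact hF'
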